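/- Fix $d\ge 3$. For a positive integer $L$ let $\mathbb{T}_L^d$ be the box $[-\frac{L-1}{2},\frac{L-1}{2}]^d\cap\mathbb{Z}^d$ if $L$ is odd and $(-\frac L2,\frac L2]^d\cap\mathbb{Z}^d$ if $L$ is even. Let $C_1,C_2,\dots$ be i.i.d. uniform on $\{\pm e_1,\dots,\pm e_d\}$, where $e_i$ are the standard unit vectors. Let $S_n=C_1+\dots+C_n$ be the simple random walk on $\mathbb{Z}^d$, and let $(R_n)_{n\ge 0}$ be the simple random walk on $\mathbb{T}_L^d$ with periodic boundary conditions: $R_0=0$, and $R_{n+1}=R_n+C_{n+1}$ if this point lies in $\mathbb{T}_L^d$, $R_{n+1}=R_n+(1-L)C_{n+1}$ otherwise. For an $\mathbb{N}$-valued random variable $\mathcal{N}$ (with $0\in\mathbb{N}$) independent of the steps $C_n$, the two-point functions of the random-length random walk (RLRW) on the torus and on $\mathbb{Z}^d$ are $$g_{\mathbb{T}_L^d}(x)=\mathbb{E}\Big(\sum_{n=0}^{\mathcal N}\mathbf 1(R_n=x)\Big),\qquad g_{\mathbb{Z}^d}(x)=\mathbb{E}\Big(\sum_{n=0}^{\mathcal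 N}\mathbf 1(S_n=x)\Big).$$ Let $(x_L)_{L\ge 1}$ be a sequence in $\mathbb{Z}^d$ with $x_L\in\mathbb{T}_L^d$, and let $(\mathcal{N}_L)_{L\ge 1}$ be a sequence of $\mathbb{N}$-valued random variables, with $\mathbb{E}(\mathcal{N}_L)<\infty$ for all large $L$; below, both two-point functions are taken with $\mathcal N=\mathcal{N}_L$. Then, as $L\to\infty$: (i) If $\mathbb{E}(\mathcal{N}_L)=o(L^2)$, then $g_{\mathbb{T}_L^d}(x_L)-g_{\mathbb{Z}^d}(x_L)=O(\mathbb{E}(\mathcal{N}_L)L^{-d})$. (ii) If $\mathbb{E}(\mathcal{N}_L)=\Omega(L^2)$, then $g_{\mathbb{T}_L^d}(x_L)-g_{\mathbb{Z}^d}(x_L)\asymp\mathbb{E}(\mathcal{N}_L)L^{-d}$, that is, there are constants $c_1,c_2>0$ such that $c_1\,\mathbb{E}(\mathcal{N}_L)L^{-d}\le g_{\mathbb{T}_L^d}(x_L)-g_{\mathbb{Z}^d}(x_L)\le c_2\,\mathbb{E}(\mathcal{N}_L)L^{-d}$ for all large $L$. (iii) If $\mathbb{E}(\mathcal{N}_L)=\omega(L^2)$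 and the Euclidean norm satisfies $\|x_L\|=o(L)$, then $g_{\mathbb{T}_L^d}(x_L)-g_{\mathbb{Z}^d}(x_L)\sim\mathbb{E}(\mathcal{N}_L)L^{-d}$, that is, the ratio of the two sides tends to $1$. -/

import Mathlib

open MeasureTheory ProbabilityTheory Filter Asymptotics

/-- The unit steps `±e₁, …, ±e_d` of the lattice `ℤ^d`. -/
def unitSteps (d : ℕ) : Set (Fin d → ℤ) :=
  {v | ∃ i : Fin d, v = Pi.single i 1 ∨ v = -Pi.single i 1}

/-- The box of side length `L` in `ℤ^d` that represents the torus: the integer points of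
`[-(L-1)/2, (L-1)/2]^d` if `L` is odd and of `(-L/2, L/2]^d` if `L` is even
(the inequalities are multiplied by `2`). -/
def torusBox (d L : ℕ) : Set (Fin d → ℤ) :=
  {x | ∀ i, if Odd L then -((L : ℤ) - 1) ≤ 2 * x i ∧ 2 * x i ≤ (L : ℤ) - 1
    else -(L : ℤ) < 2 * x i ∧ 2 * x i ≤ (L : ℤ)}

/-- The Euclidean norm of a lattice point. -/
noncomputable def latticeNorm {d : ℕ} (x : Fin d → ℤ) : ℝ :=
  Real.sqrt (∑ i, (x i : ℝ) ^ 2)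

/-- The walk on `ℤ^d` started at the origin and driven by the steps `c 1, c 2, …`. -/
def latticeWalk {d : ℕ} (c : ℕ → Fin d → ℤ) : ℕ → Fin d → ℤ
  | 0 => 0
  | n + 1 => latticeWalk c n + c (n + 1)

open Classical in
/-- The walk on the box of side length `L` with periodic boundary conditions, started at the
origin and driven by the steps `c 1, c 2, …`. A step that would leave the box is replaced by
`(1 - L)` times that step. -/
noncomputable def torusWalk {d : ℕ} (L : ℕ) (c : ℕ → Fin d → ℤ) : ℕ → Fin d → ℤ
  | 0 => 0
  | n + 1 =>
    if torusWalk L c n + c (n + 1) ∈ torusBox d L then torusWalk L c n + c (n + 1)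
    else torusWalk L c n + (1 - (L : ℤ)) • c (n + 1)

/-- `(C_n)` is an i.i.d. sequence of uniform random variables on `{±e₁, …, ±e_d}`, and `N` is an
`ℕ`-valued random variable independent of the sequence `(C_n)`. -/
structure IsRLRWData {d : ℕ} {Ω : Type*} [MeasurableSpace Ω] (P : Measure Ω)
    (C : ℕ → Ω → Fin d → ℤ) (N : Ω → ℕ) : Prop where
  measurable_step : ∀ n, Measurable (C n)
  law_step : ∀ n, P.map (C n) = uniformOn (unitSteps d)
  indep_steps : iIndepFun C P
  measurable_length : Measurable N
  indep_length : IndepFun (fun ω n => C n ω) N P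

open Classical in
/-- The expected number of visits to `x` of a process `R` up to and including time `N`,
`𝔼 (∑_{n=0}^{N} 1(R_n = x))`. -/
noncomputable def expectedVisits {d : ℕ} {Ω : Type*} [MeasurableSpace Ω] (P : Measure Ω)
    (R : ℕ → Ω → Fin d → ℤ) (N : Ω → ℕ) (x : Fin d → ℤ) : ℝ :=
  ∫ ω, ∑ n ∈ Finset.range (N ω + 1), (if R n ω = x then (1 : ℝ) else 0) ∂P

/-- The two-point function of the random-length random walk on `ℤ^d`. -/
noncomputable def twoPointLattice {d : ℕ} {Ω : Type*} [MeasurableSpace Ω] (P : Measure Ω)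
    (C : ℕ → Ω → Fin d → ℤ) (N : Ω → ℕ) (x : Fin d → ℤ) : ℝ :=
  expectedVisits P (fun n ω => latticeWalk (fun k => C k ω) n) N x

/-- The two-point function of the random-length random walk on the torus of side length `L`. -/
noncomputable def twoPointTorus {d : ℕ} (L : ℕ) {Ω : Type*} [MeasurableSpace Ω] (P : Measure Ω)
    (C : ℕ → Ω → Fin d → ℤ) (N : Ω → ℕ) (x : Fin d → ℤ) : ℝ :=
  expectedVisits P (fun n ω => torusWalk L (fun k => C k ω) n) N x

/-- The mean walk length. -/
noncomputable def meanLength {Ω : Type*} [MeasurableSpace Ω] (P : Measure Ω) (N : Ω → ℕ) : ℝ :=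
  ∫ ω, (N ω : ℝ) ∂P

/-! The torus walk is the lattice walk reduced modulo `L`, so at a fixed time `n` the torus kernel
at `x` is the sum of the lattice kernel over all images `x + Lz`. Let `q n` be the torus kernel
minus the lattice kernel, that is, the contribution of the images with `z ≠ 0`. As the length is
independent of the steps, Fubini turns the difference of the two-point functions into the
expectation of `excessVisits`, the sum of `q n` over `n ≤ N` (`IsRLRWData.twoPoint_sub_eq`). What
remains is deterministic, with bounds uniform over `x` in the box.

Four facts suffice: `q n ≥ 0` and `q 0 = 0`; `q n ≤ C / L^d` at all times
(`exists_torusProb_sub_latticeProb_le`); `q n + q (n + 1) ≥ c / L^d` once `n ≥ ε L²`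
(`exists_le_excess_add`); and `q n + q (n + 1)` is within `δ / L^d` of `2 / L^d` once `n ≥ K L²`
(`exists_abs_excess_add_sub_le`). Summed over time they bound the excess up to time `m` by `C m /
L^d`, bound it below by `c (m - ε L² - 1) / L^d`, and place it within `(δ m + B L²) / L^d` of `m /
L^d`. These bounds are affine in `m`, so taking expectations needs only the mean length and yields
(i), (ii), (iii). Times are paired because the walk alternates between the two parity classes: only
the sum over two consecutive times is regular.

For `n ≤ L²` the image sum is controlled by the bound `C n^(-d/2) exp(-|y_j| / √n)` on the lattice
kernel, from a Fourier integral at a complex frequency. For `n` between `ε L²` and `K L²` a single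
image, estimated by a local central limit theorem, gives the lower bound. For large multiples of
`L²` the Fourier sum on the torus is dominated by the zero frequency. -/

/-- The average of `f` over the nearest neighbours of `y`. -/
noncomputable def stepAverage {d : ℕ} (f : (Fin d → ℤ) → ℝ) (y : Fin d → ℤ) : ℝ :=
  (2 * d : ℝ)⁻¹ * ∑ i, (f (y + Pi.single i 1) + f (y - Pi.single i 1))

/-- The sublattice `(Lℤ)^d`. -/
def multiples (d L : ℕ) : Set (Fin d → ℤ) := {y | ∀ i, (L : ℤ) ∣ y i}

/-- The probability that simple random walk on `ℤ^d` is at `y` at time `n`. -/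
noncomputable def latticeProb (d n : ℕ) : (Fin d → ℤ) → ℝ :=
  stepAverage^[n] (Set.indicator {0} 1)

/-- The probability that simple random walk on `(ℤ / L)^d` is at `y` at time `n`. -/
noncomputable def torusProb (d L n : ℕ) : (Fin d → ℤ) → ℝ :=
  stepAverage^[n] (Set.indicator (multiples d L) 1)

/-! ### The one-step law and the law of the lattice walk as iterated averaging -/

lemma single_one_injective (d : ℕ) :
    Function.Injective (fun i : Fin d => (Pi.single i 1 : Fin d → ℤ)) := by
  intro i j h
  by_contra hij
  have := congrFun h i
  simp [hij] at this

lemma single_one_ne_neg_single_one {d : ℕ} (i j : Fin d) :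
    (Pi.single i 1 : Fin d → ℤ) ≠ -Pi.single j 1 := by
  intro h
  have := congrFun h i
  simp only [Pi.single_eq_same, Pi.neg_apply, Pi.single_apply] at this
  split_ifs at this
  all_goals omega

lemma integral_uniformOn_unitSteps {d : ℕ} (f : (Fin d → ℤ) → ℝ) :
    ∫ v, f v ∂(uniformOn (unitSteps d))
      = (2 * d : ℝ)⁻¹ * ∑ i, (f (Pi.single i 1) + f (-Pi.single i 1)) := by
  classical
  set A : Finset (Fin d → ℤ) := Finset.univ.image (fun i => Pi.single i 1)
  set B : Finset (Fin d → ℤ) := Finset.univ.image (fun i => -Pi.single i 1)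
  have hAB : Disjoint A B := by
    rw [Finset.disjoint_left]
    intro v hA hB
    obtain ⟨i, -, rfl⟩ := Finset.mem_image.1 hA
    obtain ⟨j, -, hj⟩ := Finset.mem_image.1 hB
    exact single_one_ne_neg_single_one i j hj.symm
  have hinj' : Function.Injective (fun i : Fin d => (-Pi.single i 1 : Fin d → ℤ)) :=
    neg_injective.comp (single_one_injective d)
  have hS : unitSteps d = ((A ∪ B : Finset _) : Set (Fin d → ℤ)) := by
    ext v
    simp only [unitSteps, Set.mem_ofPred_eq, A, B, Finset.coe_union, Finset.coe_image,
      Finset.coe_univ, Set.image_univ, Set.mem_union, Set.mem_range]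
    constructor
    · rintro ⟨i, h | h⟩
      · exact Or.inl ⟨i, h.symm⟩
      · exact Or.inr ⟨i, h.symm⟩
    · rintro (⟨i, h⟩ | ⟨i, h⟩)
      · exact ⟨i, Or.inl h.symm⟩
      · exact ⟨i, Or.inr h.symm⟩
  have hcard : (A ∪ B).card = 2 * d := by
    rw [Finset.card_union_of_disjoint hAB,
      Finset.card_image_of_injective _ (single_one_injective d),
      Finset.card_image_of_injective _ hinj']
    simp [two_mul]
  rw [hS, uniformOn, ProbabilityTheory.cond, integral_smul_measure, setIntegral_finset]
  · simp only [Measure.count_apply_finset, hcard, Measure.real, Measure.count_singleton,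
      ENNReal.toReal_one, one_smul]
    rw [Finset.sum_union hAB, Finset.sum_image (single_one_injective d).injOn,
      Finset.sum_image hinj'.injOn, ← Finset.sum_add_distrib]
    simp
  · rw [← Set.biUnion_of_singleton ((A ∪ B : Finset _) : Set (Fin d → ℤ))]
    refine integrableOn_finset_iUnion.2 fun i _ => integrableOn_singleton (by finiteness) ?_
    simp

lemma latticeWalk_eq_sum {d : ℕ} (c : ℕ → Fin d → ℤ) (n : ℕ) :
    latticeWalk c n = ∑ k ∈ Finset.range n, c (k + 1) := by
  induction n with
  | zero => rfl
  | succ n ih => rw [Finset.sum_range_succ, ← ih]; rfl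

lemma measurable_latticeWalk {d : ℕ} (n : ℕ) :
    Measurable (fun c : ℕ → Fin d → ℤ => latticeWalk c n) := by
  simp_rw [latticeWalk_eq_sum]
  exact Finset.measurable_sum _ (fun k _ => measurable_pi_apply _)

lemma measurable_torusWalk {d : ℕ} (L n : ℕ) :
    Measurable (fun c : ℕ → Fin d → ℤ => torusWalk L c n) := by
  induction n with
  | zero => exact measurable_const
  | succ n ih =>
    have h : Measurable (fun p : (Fin d → ℤ) × (Fin d → ℤ) =>
        (open Classical in if p.1 + p.2 ∈ torusBox d L then p.1 + p.2
          else p.1 + (1 - (L : ℤ)) • p.2)) := measurable_of_countable _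
    exact h.comp (ih.prodMk (measurable_pi_apply (n + 1)))

lemma abs_stepAverage_le {d : ℕ} {f : (Fin d → ℤ) → ℝ} {B : ℝ} (hf : ∀ y, |f y| ≤ B)
    (y : Fin d → ℤ) : |stepAverage f y| ≤ B := by
  have hB : 0 ≤ B := (abs_nonneg _).trans (hf y)
  rw [stepAverage, abs_mul]
  have h1 : |∑ i : Fin d, (f (y + Pi.single i 1) + f (y - Pi.single i 1))| ≤ 2 * d * B := by
    refine (Finset.abs_sum_le_sum_abs _ _).trans ?_
    refine (Finset.sum_le_sum (g := fun _ => 2 * B) fun i _ => ?_).trans (by simp; linarith)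
    refine (abs_add_le _ _).trans ?_
    linarith [hf (y + Pi.single i 1), hf (y - Pi.single i 1)]
  rcases Nat.eq_zero_or_pos d with rfl | hd
  · simpa using hB
  have h2 : (0 : ℝ) < 2 * d := by positivity
  rw [abs_of_pos (inv_pos.2 h2), inv_mul_le_iff₀ h2]
  linarith

/-- Integrating out the last step, which is independent of the earlier ones, replaces `f` by
`stepAverage f`. Hence `f` is quantified inside the induction; its bound `B` serves integrability
and is preserved by averaging. -/
lemma integral_comp_sub_latticeWalk {d : ℕ} {Ω : Type*} [MeasurableSpace Ω] {P : Measure Ω}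
    [IsProbabilityMeasure P] {C : ℕ → Ω → Fin d → ℤ} (hC : ∀ n, Measurable (C n))
    (hlaw : ∀ n, P.map (C n) = uniformOn (unitSteps d)) (hind : iIndepFun C P) (n : ℕ) :
    ∀ {f : (Fin d → ℤ) → ℝ} {B : ℝ}, (∀ y, |f y| ≤ B) → ∀ y : Fin d → ℤ,
      ∫ ω, f (y - latticeWalk (fun k => C k ω) n) ∂P = stepAverage^[n] f y := by
  induction n with
  | zero => intro f B hf y; simp [latticeWalk]
  | succ n ih =>
    intro f B hf y
    have hS : Measurable (fun ω => latticeWalk (fun k => C k ω) n) :=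
      (measurable_latticeWalk n).comp (measurable_pi_lambda _ hC)
    -- The walk starts with `C 1`, so the independent family is first shifted by one index.
    have hindep : IndepFun (fun ω => latticeWalk (fun k => C k ω) n) (C (n + 1)) P := by
      have h := (hind.precomp (add_left_injective 1)).indepFun_sum_range_succ
        (fun i => hC (i + 1)) n
      convert h using 1
      ext1 ω
      rw [latticeWalk_eq_sum, Finset.sum_apply]
    have hprod := hindep.map_prod_eq_prod_map_map hS.aemeasurable (hC (n + 1)).aemeasurable
    have : IsProbabilityMeasure (P.map (C (n + 1))) :=
      Measure.isProbabilityMeasure_map (hC _).aemeasurable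
    have : IsProbabilityMeasure (P.map (fun ω => latticeWalk (fun k => C k ω) n)) :=
      Measure.isProbabilityMeasure_map hS.aemeasurable
    calc ∫ ω, f (y - latticeWalk (fun k => C k ω) (n + 1)) ∂P
        = ∫ z, f (y - (z.1 + z.2)) ∂(P.map
            (fun ω => (latticeWalk (fun k => C k ω) n, C (n + 1) ω))) := by
          rw [integral_map (hS.prodMk (hC _)).aemeasurable
            (measurable_of_countable _).aestronglyMeasurable]
          rfl
      _ = ∫ s, ∫ e, f (y - (s + e)) ∂(P.map (C (n + 1)))
            ∂(P.map (fun ω => latticeWalk (fun k => C k ω) n)) := by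
          rw [hprod, integral_prod]
          exact Integrable.of_bound (measurable_of_countable _).aestronglyMeasurable B
            (Eventually.of_forall fun z => hf _)
      _ = ∫ s, stepAverage f (y - s) ∂(P.map (fun ω => latticeWalk (fun k => C k ω) n)) := by
          congr 1
          ext1 s
          rw [hlaw, integral_uniformOn_unitSteps, stepAverage]
          congr 1
          refine Finset.sum_congr rfl fun i _ => ?_
          rw [add_comm]
          congr 2 <;> abel
      _ = stepAverage^[n + 1] f y := by
          rw [integral_map hS.aemeasurable (measurable_of_countable _).aestronglyMeasurable,
            ih (abs_stepAverage_le hf), Function.iterate_succ_apply]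

/-! ### The box as a fundamental domain for reduction modulo `L` -/

lemma torusBox_unique {d L : ℕ} (hL : 0 < L) {x y : Fin d → ℤ} (hx : x ∈ torusBox d L)
    (hy : y ∈ torusBox d L) (h : x - y ∈ multiples d L) : x = y := by
  ext i
  have h1 := hx i
  have h2 := hy i
  obtain ⟨k, hk⟩ := h i
  simp only [Pi.sub_apply] at hk
  have hL' : (0 : ℤ) < L := by exact_mod_cast hL
  have hk0 : k = 0 := by
    by_contra hne
    rcases lt_or_gt_of_ne hne with hlt | hgt
    · have : (L : ℤ) * k ≤ -L := by nlinarith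
      split_ifs at h1 h2 <;> omega
    · have : (L : ℤ) ≤ L * k := by nlinarith
      split_ifs at h1 h2 <;> omega
  subst hk0
  omega

/-- A unit step can leave the box only through a face orthogonal to it; subtracting `L • v`
re-enters at the opposite face. The two parities of `L` have different inequalities and are checked
separately. -/
lemma step_mem_torusBox {d L : ℕ} {r v : Fin d → ℤ} (hr : r ∈ torusBox d L)
    (hv : v ∈ unitSteps d) (h : r + v ∉ torusBox d L) :
    r + (1 - (L : ℤ)) • v ∈ torusBox d L := by
  obtain ⟨i, hi⟩ := hv
  have hoff : ∀ j, j ≠ i → v j = 0 := by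
    intro j hj
    rcases hi with rfl | rfl <;> simp [hj]
  have hvi : v i = 1 ∨ v i = -1 := by
    rcases hi with rfl | rfl <;> simp
  have hnot : ¬ (if Odd L then -((L : ℤ) - 1) ≤ 2 * (r i + v i) ∧ 2 * (r i + v i) ≤ (L : ℤ) - 1
      else -(L : ℤ) < 2 * (r i + v i) ∧ 2 * (r i + v i) ≤ (L : ℤ)) := by
    intro hin
    apply h
    intro j
    by_cases hj : j = i
    · subst hj; exact hin
    · have := hr j
      simpa [hoff j hj] using this
  intro j
  by_cases hj : j = i
  · subst hj
    have h1 := hr j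
    simp only [Pi.add_apply, Pi.smul_apply, smul_eq_mul]
    rcases Nat.even_or_odd L with he | ho
    · have hne : ¬ Odd L := Nat.not_odd_iff_even.2 he
      obtain ⟨m, hm⟩ := he
      simp only [hne, if_false] at h1 hnot ⊢
      rcases hvi with hv | hv <;> rw [hv] at hnot ⊢ <;> omega
    · simp only [ho, if_true] at h1 hnot ⊢
      obtain ⟨m, hm⟩ := ho
      rcases hvi with hv | hv <;> rw [hv] at hnot ⊢ <;> omega
  · have := hr j
    simpa [hoff j hj] using this

lemma torusWalk_mem_and_sub_mem {d L : ℕ} (hL : 0 < L) {c : ℕ → Fin d → ℤ}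
    (hc : ∀ n, c n ∈ unitSteps d) (n : ℕ) :
    torusWalk L c n ∈ torusBox d L ∧ torusWalk L c n - latticeWalk c n ∈ multiples d L := by
  induction n with
  | zero =>
    refine ⟨fun i => ?_, fun i => ?_⟩
    · simp only [torusWalk, Pi.zero_apply]
      split_ifs <;> omega
    · simp [torusWalk, latticeWalk]
  | succ n ih =>
    simp only [torusWalk, latticeWalk]
    split_ifs with h
    · refine ⟨h, ?_⟩
      simpa using ih.2
    · refine ⟨step_mem_torusBox ih.1 (hc _) h, fun i => ?_⟩
      have h2 := ih.2 i
      simp only [Pi.sub_apply, Pi.add_apply, Pi.smul_apply, smul_eq_mul] at h2 ⊢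
      have : torusWalk L c n i + (1 - (L : ℤ)) * c (n + 1) i - (latticeWalk c n i + c (n + 1) i)
          = (torusWalk L c n i - latticeWalk c n i) - L * c (n + 1) i := by ring
      rw [this]
      exact dvd_sub h2 (dvd_mul_right _ _)

/-- This puts a visit of the torus walk in terms of the lattice walk, so both kernels become
iterates of the same operator, started from different indicators. -/
lemma torusWalk_eq_iff {d L : ℕ} (hL : 0 < L) {c : ℕ → Fin d → ℤ}
    (hc : ∀ n, c n ∈ unitSteps d) (n : ℕ) {x : Fin d → ℤ} (hx : x ∈ torusBox d L) :
    torusWalk L c n = x ↔ x - latticeWalk c n ∈ multiples d L := by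
  obtain ⟨h1, h2⟩ := torusWalk_mem_and_sub_mem hL hc n
  constructor
  · rintro rfl; exact h2
  · intro h
    refine torusBox_unique hL h1 hx fun i => ?_
    have := dvd_sub (h2 i) (h i)
    simpa using this

/-! ### Conditioning on the random length -/

/-- The expected number of visits to `x` by time `m`, of the torus walk minus that of the
lattice walk. -/
noncomputable def excessVisits (d L : ℕ) (x : Fin d → ℤ) (m : ℕ) : ℝ :=
  ∑ n ∈ Finset.range (m + 1), (torusProb d L n x - latticeProb d n x)

/-- Fubini for the joint law of steps and length, which is a product by independence; the visit
count is dominated by `N + 1`. The walk is an arbitrary measurable functional `F` of the steps, so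
the lemma serves both walks. -/
lemma IsRLRWData.integrable_visits_and_eq {d : ℕ} {Ω : Type*} [MeasurableSpace Ω] {P : Measure Ω}
    [IsProbabilityMeasure P] {C : ℕ → Ω → Fin d → ℤ} {N : Ω → ℕ} (h : IsRLRWData P C N)
    (hN : Integrable (fun ω => (N ω : ℝ)) P) {F : (ℕ → Fin d → ℤ) → ℕ → Fin d → ℤ}
    (hF : ∀ n, Measurable (fun c => F c n)) {x : Fin d → ℤ} {p : ℕ → ℝ}
    (hp : ∀ n, P.real {ω | F (fun k => C k ω) n = x} = p n) :
    Integrable (fun ω => ∑ n ∈ Finset.range (N ω + 1), p n) P ∧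
    expectedVisits P (fun n ω => F (fun k => C k ω) n) N x
      = ∫ ω, ∑ n ∈ Finset.range (N ω + 1), p n ∂P := by
  classical
  have hCm : Measurable (fun ω n => C n ω) := measurable_pi_lambda _ h.measurable_step
  have hNm := h.measurable_length
  have : IsProbabilityMeasure (P.map (fun ω n => C n ω)) :=
    Measure.isProbabilityMeasure_map hCm.aemeasurable
  have : IsProbabilityMeasure (P.map N) := Measure.isProbabilityMeasure_map hNm.aemeasurable
  set G : (ℕ → Fin d → ℤ) × ℕ → ℝ :=
    fun z => ∑ n ∈ Finset.range (z.2 + 1), (if F z.1 n = x then (1 : ℝ) else 0) with hG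
  have hind : ∀ n, Measurable (fun c => if F c n = x then (1 : ℝ) else 0) := fun n =>
    Measurable.ite (hF n (measurableSet_singleton x)) measurable_const measurable_const
  have hGm : Measurable G := measurable_from_prod_countable_left fun m =>
    Finset.measurable_sum (Finset.range (m + 1)) fun n _ => hind n
  have hbound : ∀ z, |G z| ≤ z.2 + 1 := by
    intro z
    refine (Finset.abs_sum_le_sum_abs _ _).trans ?_
    refine (Finset.sum_le_sum (g := fun _ => (1 : ℝ)) fun n _ => ?_).trans (by simp)
    split_ifs <;> simp
  have hp1 : ∀ n, |p n| ≤ 1 := fun n => by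
    rw [← hp, abs_of_nonneg measureReal_nonneg]; exact measureReal_le_one
  have hN1 : Integrable (fun ω => (N ω : ℝ) + 1) P := hN.add (integrable_const 1)
  have hZm : Measurable (fun ω => ((fun n => C n ω), N ω)) := hCm.prodMk hNm
  have hGi : Integrable G (P.map (fun ω => ((fun n => C n ω), N ω))) := by
    rw [integrable_map_measure hGm.aestronglyMeasurable hZm.aemeasurable]
    exact hN1.mono' (hGm.comp hZm).aestronglyMeasurable
      (Eventually.of_forall fun ω => hbound _)
  have hprod := h.indep_length.map_prod_eq_prod_map_map hCm.aemeasurable hNm.aemeasurable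
  refine ⟨hN1.mono' ((measurable_of_countable
    (fun m => ∑ n ∈ Finset.range (m + 1), p n)).comp hNm).aestronglyMeasurable
    (Eventually.of_forall fun ω => ?_), ?_⟩
  · refine (Finset.abs_sum_le_sum_abs _ _).trans ?_
    exact (Finset.sum_le_sum (g := fun _ => (1 : ℝ)) fun n _ => hp1 n).trans (by simp)
  · calc expectedVisits P (fun n ω => F (fun k => C k ω) n) N x
        = ∫ z, G z ∂(P.map (fun ω => ((fun n => C n ω), N ω))) := by
          rw [integral_map hZm.aemeasurable hGm.aestronglyMeasurable, expectedVisits]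
      _ = ∫ m, ∫ c, G (c, m) ∂(P.map (fun ω n => C n ω)) ∂(P.map N) := by
          rw [hprod, integral_prod_symm]
          rwa [← hprod]
      _ = ∫ m, ∑ n ∈ Finset.range (m + 1), p n ∂(P.map N) := by
          refine integral_congr_ae (Eventually.of_forall fun m => ?_)
          simp only [hG]
          rw [integral_finsetSum _ fun n _ => Integrable.of_bound (hind n).aestronglyMeasurable 1
            (Eventually.of_forall fun c => by split_ifs <;> simp)]
          refine Finset.sum_congr rfl fun n _ => ?_
          rw [integral_map hCm.aemeasurable (hind n).aestronglyMeasurable, ← hp]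
          have hm : MeasurableSet {ω | F (fun k => C k ω) n = x} :=
            ((hF n).comp hCm) (measurableSet_singleton x)
          rw [← integral_indicator_one hm]
          refine integral_congr_ae (Eventually.of_forall fun ω => ?_)
          simp [Set.indicator_apply]
      _ = _ := integral_map hNm.aemeasurable (measurable_of_countable _).aestronglyMeasurable

lemma abs_indicator_one_le {α : Type*} (s : Set α) (y : α) :
    |s.indicator (1 : α → ℝ) y| ≤ 1 := by
  by_cases h : y ∈ s <;> simp [h]

lemma IsRLRWData.ae_mem_unitSteps {d : ℕ} {Ω : Type*} [MeasurableSpace Ω] {P : Measure Ω}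
    {C : ℕ → Ω → Fin d → ℤ} {N : Ω → ℕ} (h : IsRLRWData P C N) :
    ∀ᵐ ω ∂P, ∀ n, C n ω ∈ unitSteps d := by
  rw [ae_all_iff]
  intro n
  have h1 : ∀ᵐ v ∂(P.map (C n)), v ∈ unitSteps d := by
    rw [h.law_step]
    exact ae_cond_mem (Set.to_countable _).measurableSet
  exact ae_of_ae_map (h.measurable_step n).aemeasurable h1

lemma IsRLRWData.twoPoint_sub_eq {d L : ℕ} (hL : 0 < L) {Ω : Type*} [MeasurableSpace Ω]
    {P : Measure Ω} [IsProbabilityMeasure P] {C : ℕ → Ω → Fin d → ℤ} {N : Ω → ℕ}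
    (h : IsRLRWData P C N) (hN : Integrable (fun ω => (N ω : ℝ)) P) {x : Fin d → ℤ}
    (hx : x ∈ torusBox d L) :
    Integrable (fun ω => excessVisits d L x (N ω)) P ∧
    twoPointTorus L P C N x - twoPointLattice P C N x = ∫ ω, excessVisits d L x (N ω) ∂P := by
  have hprob : ∀ (s : Set (Fin d → ℤ)) (n : ℕ),
      P.real {ω | x - latticeWalk (fun k => C k ω) n ∈ s} = stepAverage^[n] (s.indicator 1) x := by
    intro s n
    rw [← integral_comp_sub_latticeWalk h.measurable_step h.law_step h.indep_steps n
      (abs_indicator_one_le s) x]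
    have hm : MeasurableSet {ω | x - latticeWalk (fun k => C k ω) n ∈ s} :=
      (measurable_const.sub ((measurable_latticeWalk n).comp
        (measurable_pi_lambda _ h.measurable_step))) (Set.to_countable s).measurableSet
    rw [← integral_indicator_one hm]
    rfl
  have h1 := h.integrable_visits_and_eq hN (F := latticeWalk) measurable_latticeWalk
    (x := x) (p := fun n => latticeProb d n x) (fun n => by
      rw [latticeProb, ← hprob]
      congr 1
      ext ω
      simp [sub_eq_zero, eq_comm])
  have h2 := h.integrable_visits_and_eq hN (F := torusWalk L) (measurable_torusWalk L)
    (x := x) (p := fun n => torusProb d L n x) (fun n => by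
      rw [torusProb, ← hprob]
      refine measureReal_congr ?_
      filter_upwards [h.ae_mem_unitSteps] with ω hω
      exact propext (torusWalk_eq_iff hL hω n hx))
  refine ⟨?_, ?_⟩
  · simp only [excessVisits, Finset.sum_sub_distrib]
    exact h2.1.sub h1.1
  · rw [twoPointTorus, twoPointLattice, h1.2, h2.2, ← integral_sub h2.1 h1.1]
    simp only [excessVisits, Finset.sum_sub_distrib]

/-! ### Fourier representation of the lattice kernel at complex frequencies -/

/-- The Fourier symbol of `stepAverage` at a complex frequency. -/
noncomputable def stepSymbol {d : ℕ} (ζ : Fin d → ℂ) : ℂ := (∑ i, Complex.cos (ζ i)) / d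

/-- The exponential function on `ℤ^d` with a complex frequency. -/
noncomputable def latticeExp {d : ℕ} (ζ : Fin d → ℂ) (y : Fin d → ℤ) : ℂ :=
  Complex.exp (Complex.I * ∑ i, ζ i * y i)

lemma latticeExp_add {d : ℕ} (ζ : Fin d → ℂ) (y z : Fin d → ℤ) :
    latticeExp ζ (y + z) = latticeExp ζ y * latticeExp ζ z := by
  rw [latticeExp, latticeExp, latticeExp, ← Complex.exp_add, ← mul_add, ← Finset.sum_add_distrib]
  congr 2
  refine Finset.sum_congr rfl fun i _ => ?_
  push_cast [Pi.add_apply]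
  ring

lemma latticeExp_single {d : ℕ} (ζ : Fin d → ℂ) (i : Fin d) (m : ℤ) :
    latticeExp ζ (Pi.single i m) = Complex.exp (Complex.I * (ζ i * m)) := by
  rw [latticeExp]
  congr 2
  rw [Finset.sum_eq_single i]
  · simp
  · intro j _ hj
    simp [hj]
  · simp

lemma sum_latticeExp_neighbours {d : ℕ} (ζ : Fin d → ℂ) (y : Fin d → ℤ) :
    (2 * d : ℂ)⁻¹ * ∑ i, (latticeExp ζ (y + Pi.single i 1) + latticeExp ζ (y - Pi.single i 1))
      = stepSymbol ζ * latticeExp ζ y := by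
  have h : ∀ i, latticeExp ζ (y + Pi.single i 1) + latticeExp ζ (y - Pi.single i 1)
      = 2 * (Complex.cos (ζ i) * latticeExp ζ y) := by
    intro i
    rw [sub_eq_add_neg, ← Pi.single_neg, latticeExp_add, latticeExp_add, latticeExp_single,
      latticeExp_single, Complex.cos]
    push_cast
    ring_nf
  rw [Finset.sum_congr rfl fun i _ => h i, ← Finset.mul_sum, ← Finset.sum_mul, stepSymbol, mul_inv,
    div_eq_mul_inv]
  ring

lemma ofReal_stepAverage {d : ℕ} (f : (Fin d → ℤ) → ℝ) (y : Fin d → ℤ) :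
    ((stepAverage f y : ℝ) : ℂ)
      = (2 * d : ℂ)⁻¹ * ∑ i, ((f (y + Pi.single i 1) : ℂ) + (f (y - Pi.single i 1) : ℂ)) := by
  simp [stepAverage]

/-- Exponentials are eigenfunctions of averaging, at complex frequencies too, so a representation
valid at time `0` propagates to every time with a power of the symbol. -/
lemma iterate_stepAverage_eq_integral {d : ℕ} {Θ : Type*} [MeasurableSpace Θ] {ν : Measure Θ}
    {ζ : Θ → Fin d → ℂ} {f : (Fin d → ℤ) → ℝ}
    (hint : ∀ n y, Integrable (fun θ => stepSymbol (ζ θ) ^ n * latticeExp (ζ θ) y) ν)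
    (h0 : ∀ y, (f y : ℂ) = ∫ θ, latticeExp (ζ θ) y ∂ν) (n : ℕ) :
    ∀ y, ((stepAverage^[n] f y : ℝ) : ℂ)
      = ∫ θ, stepSymbol (ζ θ) ^ n * latticeExp (ζ θ) y ∂ν := by
  induction n with
  | zero => intro y; simpa using h0 y
  | succ n ih =>
    intro y
    rw [Function.iterate_succ_apply', ofReal_stepAverage]
    simp_rw [ih]
    have hadd : ∀ i : Fin d,
        (∫ θ, stepSymbol (ζ θ) ^ n * latticeExp (ζ θ) (y + Pi.single i 1) ∂ν)
          + ∫ θ, stepSymbol (ζ θ) ^ n * latticeExp (ζ θ) (y - Pi.single i 1) ∂ν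
        = ∫ θ, (stepSymbol (ζ θ) ^ n * latticeExp (ζ θ) (y + Pi.single i 1)
          + stepSymbol (ζ θ) ^ n * latticeExp (ζ θ) (y - Pi.single i 1)) ∂ν := fun i =>
      (integral_add (hint n _) (hint n _)).symm
    have hint2 : ∀ i ∈ Finset.univ, Integrable (fun θ =>
        stepSymbol (ζ θ) ^ n * latticeExp (ζ θ) (y + Pi.single (i : Fin d) 1)
          + stepSymbol (ζ θ) ^ n * latticeExp (ζ θ) (y - Pi.single i 1)) ν := fun i _ =>
      (hint n _).add (hint n _)
    rw [Finset.sum_congr rfl fun i _ => hadd i, ← integral_finsetSum _ hint2,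
      ← integral_const_mul]
    refine integral_congr_ae (Eventually.of_forall fun θ => ?_)
    simp only
    rw [pow_succ, mul_assoc, ← sum_latticeExp_neighbours]
    simp_rw [← mul_add]
    rw [← Finset.mul_sum]
    ring

/-- Lebesgue measure on the cube `[-π, π]^d`. -/
noncomputable def cubeMeasure (d : ℕ) : Measure (Fin d → ℝ) :=
  Measure.pi fun _ => volume.restrict (Set.Icc (-Real.pi) Real.pi)

lemma cubeMeasure_eq (d : ℕ) : cubeMeasure d
    = volume.restrict (Set.Icc (fun _ => -Real.pi) (fun _ => Real.pi)) := by
  rw [cubeMeasure, ← Measure.restrict_pi_pi, Set.pi_univ_Icc]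
  rfl

lemma Continuous.integrable_cubeMeasure {d : ℕ} {E : Type*} [NormedAddCommGroup E]
    {g : (Fin d → ℝ) → E} (hg : Continuous g) : Integrable g (cubeMeasure d) := by
  rw [cubeMeasure_eq]
  exact hg.integrableOn_Icc

/-- The frequency `θ + iλe_j`. -/
noncomputable def tiltedFrequency {d : ℕ} (j : Fin d) (lam : ℝ) (θ : Fin d → ℝ) : Fin d → ℂ :=
  fun i => θ i + ((if i = j then lam else 0 : ℝ) : ℂ) * Complex.I

lemma continuous_tiltedFrequency {d : ℕ} (j : Fin d) (lam : ℝ) :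
    Continuous (tiltedFrequency j lam) := by
  unfold tiltedFrequency
  fun_prop

lemma continuous_stepSymbol {d : ℕ} : Continuous (stepSymbol (d := d)) := by
  unfold stepSymbol
  fun_prop

lemma continuous_latticeExp {d : ℕ} (y : Fin d → ℤ) :
    Continuous (fun ζ : Fin d → ℂ => latticeExp ζ y) := by
  unfold latticeExp
  fun_prop

lemma integral_Icc_exp_int (m : ℤ) :
    ∫ t in Set.Icc (-Real.pi) Real.pi, Complex.exp (Complex.I * (t * m))
      = if m = 0 then (2 * Real.pi : ℂ) else 0 := by
  rw [integral_Icc_eq_integral_Ioc, ← intervalIntegral.integral_of_le (by linarith [Real.pi_pos])]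
  split_ifs with hm
  · subst hm
    simp
    ring
  · have hc : (Complex.I * m : ℂ) ≠ 0 := mul_ne_zero Complex.I_ne_zero (by exact_mod_cast hm)
    have h : ∀ t : ℝ, Complex.exp (Complex.I * (t * m)) = Complex.exp ((Complex.I * m) * t) := by
      intro t; ring_nf
    simp_rw [h]
    rw [integral_exp_mul_complex hc]
    have h2 : Complex.exp (Complex.I * m * (Real.pi : ℝ))
        = Complex.exp (Complex.I * m * ((-Real.pi : ℝ) : ℂ)) := by
      rw [Complex.exp_eq_exp_iff_exists_int]
      exact ⟨m, by push_cast; ring⟩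
    rw [h2]
    simp

/-- The tilt contributes only the factor `exp (-lam * y j)`, constant in `θ` and equal to `1` at `y
= 0`; for `y ≠ 0` some one-dimensional integral vanishes. As the tilted representation holds at time
`0`, it propagates by the eigenfunction relation and no contour has to be shifted. -/
lemma integral_latticeExp_tiltedFrequency {d : ℕ} (j : Fin d) (lam : ℝ) (y : Fin d → ℤ) :
    ∫ θ, latticeExp (tiltedFrequency j lam θ) y ∂(cubeMeasure d)
      = (2 * Real.pi) ^ d * ((Set.indicator {0} 1 y : ℝ) : ℂ) := by
  have h : ∀ θ : Fin d → ℝ, latticeExp (tiltedFrequency j lam θ) y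
      = Complex.exp (-lam * y j) * ∏ i, Complex.exp (Complex.I * (θ i * y i)) := by
    intro θ
    rw [latticeExp, ← Complex.exp_sum, ← Complex.exp_add]
    congr 1
    have : ∀ i, tiltedFrequency j lam θ i * y i
        = θ i * y i + (if i = j then lam * y j * Complex.I else 0) := by
      intro i
      rw [tiltedFrequency]
      split_ifs with hij
      · subst hij; ring
      · simp
    rw [Finset.sum_congr rfl fun i _ => this i, Finset.sum_add_distrib, mul_add, Finset.mul_sum]
    simp only [Finset.sum_ite_eq', Finset.mem_univ, if_true]
    linear_combination (lam * y j : ℂ) * Complex.I_mul_I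
  simp_rw [h]
  rw [integral_const_mul, cubeMeasure,
    integral_fintype_prod_eq_prod (fun (i : Fin d) (t : ℝ) => Complex.exp (Complex.I * (t * y i)))]
  simp_rw [integral_Icc_exp_int]
  by_cases hy : y = 0
  · subst hy
    simp
  · obtain ⟨i, hi⟩ := Function.ne_iff.1 hy
    rw [Finset.prod_eq_zero (Finset.mem_univ i) (by simpa using hi)]
    simp [hy]

lemma latticeProb_eq_integral {d : ℕ} (j : Fin d) (lam : ℝ) (n : ℕ) (y : Fin d → ℤ) :
    ((2 * Real.pi) ^ d : ℂ) * (latticeProb d n y : ℂ)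
      = ∫ θ, stepSymbol (tiltedFrequency j lam θ) ^ n * latticeExp (tiltedFrequency j lam θ) y
          ∂(cubeMeasure d) := by
  have hpi : ((2 * Real.pi) ^ d : ℂ) ≠ 0 :=
    pow_ne_zero _ (mul_ne_zero two_ne_zero (by exact_mod_cast Real.pi_ne_zero))
  have hcont : ∀ n y, Continuous (fun θ => stepSymbol (tiltedFrequency j lam θ) ^ n
      * latticeExp (tiltedFrequency j lam θ) y) := fun n y =>
    ((continuous_stepSymbol.comp (continuous_tiltedFrequency j lam)).pow n).mul
      ((continuous_latticeExp y).comp (continuous_tiltedFrequency j lam))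
  have key := iterate_stepAverage_eq_integral (f := Set.indicator {0} 1)
    (ν := ENNReal.ofReal ((2 * Real.pi) ^ d)⁻¹ • cubeMeasure d) (ζ := tiltedFrequency j lam)
    (fun n y => ((hcont n y).integrable_cubeMeasure).smul_measure ENNReal.ofReal_ne_top)
    (fun y => by
      rw [integral_smul_measure, integral_latticeExp_tiltedFrequency, ENNReal.toReal_ofReal (by positivity),
        Complex.real_smul]
      push_cast
      rw [inv_mul_cancel_left₀ hpi]) n y
  rw [latticeProb, key, integral_smul_measure, ENNReal.toReal_ofReal (by positivity),
    Complex.real_smul]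
  push_cast
  rw [mul_inv_cancel_left₀ hpi]

/-! ### Exponentially decaying upper bound for the lattice kernel -/

/-- The squared norm is exactly `cosh² b - sin² a`, and the square of the right side is at least
this when `cosh b ≤ 2`. -/
lemma norm_cos_le {a b : ℝ} (hb : Real.cosh b ≤ 2) :
    ‖Complex.cos (a + b * Complex.I)‖ ≤ Real.cosh b - Real.sin a ^ 2 / 4 := by
  have h1 := Real.one_le_cosh b
  have hs : Real.sin a ^ 2 ≤ 1 := Real.sin_sq_le_one a
  have hs0 := sq_nonneg (Real.sin a)
  have hn : ‖Complex.cos (a + b * Complex.I)‖ ^ 2 = Real.cosh b ^ 2 - Real.sin a ^ 2 := by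
    rw [← Complex.normSq_eq_norm_sq, Complex.cos_add_mul_I, ← Complex.ofReal_cos,
      ← Complex.ofReal_cosh, ← Complex.ofReal_sin, ← Complex.ofReal_sinh, Complex.normSq_apply]
    simp only [Complex.sub_re, Complex.sub_im, Complex.mul_re, Complex.mul_im, Complex.ofReal_re,
      Complex.ofReal_im, Complex.I_re, Complex.I_im]
    have e1 := Real.cosh_sq b
    have e2 := Real.sin_sq_add_cos_sq a
    have e3 : Real.cos a ^ 2 = 1 - Real.sin a ^ 2 := by linarith
    linear_combination Real.cosh b ^ 2 * e3 - Real.sin a ^ 2 * e1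
  refine le_of_sq_le_sq ?_ (by linarith)
  rw [hn]
  nlinarith

/-- Only coordinate `j` is tilted and costs `cosh lam - 1`; `1 + u ≤ exp u` then gives a product
over coordinates, whose integral over the cube factorises. -/
lemma norm_stepSymbol_le {d : ℕ} (hd : 0 < d) (j : Fin d) {lam : ℝ} (hlam : Real.cosh lam ≤ 2)
    (θ : Fin d → ℝ) : ‖stepSymbol (tiltedFrequency j lam θ)‖
      ≤ Real.exp ((Real.cosh lam - 1) / d) * ∏ i, Real.exp (-(1 / (4 * d)) * Real.sin (θ i) ^ 2) := by
  have hd' : (0 : ℝ) < d := by exact_mod_cast hd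
  have h1 : ∀ i, ‖Complex.cos (tiltedFrequency j lam θ i)‖
      ≤ (1 + if i = j then Real.cosh lam - 1 else 0) - Real.sin (θ i) ^ 2 / 4 := by
    intro i
    rw [tiltedFrequency]
    split_ifs with hij
    · refine (norm_cos_le hlam).trans (by linarith)
    · refine (norm_cos_le (by simp)).trans (by simp)
  rw [stepSymbol, norm_div, Complex.norm_natCast, ← Real.exp_sum, ← Real.exp_add]
  have h2 : ‖∑ i, Complex.cos (tiltedFrequency j lam θ i)‖
      ≤ d + (Real.cosh lam - 1) - (∑ i, Real.sin (θ i) ^ 2) / 4 := by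
    refine (norm_sum_le _ _).trans ((Finset.sum_le_sum fun i _ => h1 i).trans (le_of_eq ?_))
    rw [Finset.sum_sub_distrib, Finset.sum_add_distrib, Finset.sum_div]
    simp
  refine ((div_le_div_iff_of_pos_right hd').2 h2).trans ?_
  refine le_trans (le_of_eq ?_) (Real.add_one_le_exp _)
  rw [← Finset.mul_sum]
  field_simp
  ring

/-- `sin²` vanishes at `0`, `π` and `-π`. Jordan's inequality within `π / 2` of each zero dominates
the integrand by three Gaussians. -/
lemma integral_exp_neg_sin_sq_le {a : ℝ} (ha : 0 < a) :
    ∫ t in Set.Icc (-Real.pi) Real.pi, Real.exp (-a * Real.sin t ^ 2)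
      ≤ 3 * Real.sqrt (Real.pi / (4 / Real.pi ^ 2 * a)) := by
  set b := 4 / Real.pi ^ 2 * a with hb
  have hpi := Real.pi_pos
  have hb0 : 0 < b := by positivity
  have hg : Integrable (fun t : ℝ => Real.exp (-b * t ^ 2)) := integrable_exp_neg_mul_sq hb0
  have hg1 := hg.comp_sub_right Real.pi
  have hg2 := hg.comp_add_right Real.pi
  have key : ∀ t : ℝ, |t| ≤ Real.pi / 2 → Real.exp (-a * Real.sin t ^ 2) ≤ Real.exp (-b * t ^ 2) := by
    intro t ht
    apply Real.exp_le_exp.2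
    have h := Real.mul_abs_le_abs_sin ht
    have h2 : (2 / Real.pi * |t|) ^ 2 ≤ |Real.sin t| ^ 2 := by gcongr
    rw [mul_pow, sq_abs, sq_abs, div_pow] at h2
    have : b * t ^ 2 = a * (2 ^ 2 / Real.pi ^ 2 * t ^ 2) := by rw [hb]; ring
    nlinarith
  calc ∫ t in Set.Icc (-Real.pi) Real.pi, Real.exp (-a * Real.sin t ^ 2)
      ≤ ∫ t in Set.Icc (-Real.pi) Real.pi, (Real.exp (-b * t ^ 2)
          + Real.exp (-b * (t - Real.pi) ^ 2) + Real.exp (-b * (t + Real.pi) ^ 2)) := by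
        refine setIntegral_mono_on (Continuous.integrableOn_Icc (by fun_prop))
          ((hg.add hg1).add hg2).integrableOn measurableSet_Icc fun t ht => ?_
        have p1 := Real.exp_pos (-b * t ^ 2)
        have p2 := Real.exp_pos (-b * (t - Real.pi) ^ 2)
        have p3 := Real.exp_pos (-b * (t + Real.pi) ^ 2)
        rcases le_or_gt |t| (Real.pi / 2) with h | h
        · linarith [key t h]
        · rcases lt_abs.1 h with h | h
          · have := key (t - Real.pi) (by rw [abs_le]; constructor <;> linarith [ht.2])
            rw [Real.sin_sub_pi, neg_sq] at this
            linarith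
          · have := key (t + Real.pi) (by rw [abs_le]; constructor <;> linarith [ht.1])
            rw [Real.sin_add_pi, neg_sq] at this
            linarith
    _ ≤ ∫ t : ℝ, (Real.exp (-b * t ^ 2)
          + Real.exp (-b * (t - Real.pi) ^ 2) + Real.exp (-b * (t + Real.pi) ^ 2)) :=
        setIntegral_le_integral ((hg.add hg1).add hg2) (Eventually.of_forall fun t => by
          simp only [Pi.zero_apply]; positivity)
    _ = 3 * Real.sqrt (Real.pi / b) := by
        have hadd := integral_add (hg.add hg1) hg2
        simp only [Pi.add_apply] at hadd
        rw [hadd, integral_add hg hg1,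
          integral_sub_right_eq_self (fun t => Real.exp (-b * t ^ 2)),
          integral_add_right_eq_self (fun t => Real.exp (-b * t ^ 2)), integral_gaussian]
        ring

/-- The constant in the bound for the Fourier integral of the simple random walk. -/
noncomputable def kernelConst (d : ℕ) : ℝ := (3 * Real.sqrt (Real.pi ^ 3 * d)) ^ d

lemma kernelConst_nonneg (d : ℕ) : 0 ≤ kernelConst d := by
  unfold kernelConst; positivity

lemma integral_prod_exp_sin_sq_le {d n : ℕ} (hd : 0 < d) (hn : 0 < n) :
    ∫ θ, ∏ i, Real.exp (-(n / (4 * d)) * Real.sin (θ i) ^ 2) ∂(cubeMeasure d)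
      ≤ kernelConst d / Real.sqrt n ^ d := by
  have hd' : (0 : ℝ) < d := by exact_mod_cast hd
  have hn' : (0 : ℝ) < n := by exact_mod_cast hn
  have hpi := Real.pi_pos
  rw [cubeMeasure, integral_fintype_prod_eq_prod
    (fun (_ : Fin d) (t : ℝ) => Real.exp (-(n / (4 * d)) * Real.sin t ^ 2)), Finset.prod_const,
    Finset.card_univ, Fintype.card_fin, kernelConst, ← div_pow]
  refine pow_le_pow_left₀ (setIntegral_nonneg measurableSet_Icc fun t _ => (Real.exp_pos _).le) ?_ d
  refine (integral_exp_neg_sin_sq_le (by positivity)).trans (le_of_eq ?_)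
  rw [mul_div_assoc, ← Real.sqrt_div (by positivity)]
  congr 2
  field_simp

lemma norm_latticeExp_tiltedFrequency {d : ℕ} (j : Fin d) (lam : ℝ) (θ : Fin d → ℝ)
    (y : Fin d → ℤ) :
    ‖latticeExp (tiltedFrequency j lam θ) y‖ = Real.exp (-lam * y j) := by
  rw [latticeExp, Complex.norm_exp]
  congr 1
  rw [Complex.I_mul_re, Complex.im_sum, ← Finset.sum_neg_distrib, Finset.sum_eq_single j]
  · simp [tiltedFrequency]
  · intro i _ hij
    simp [tiltedFrequency, hij]
  · simp

lemma latticeProb_le_of_tilt {d n : ℕ} (hd : 0 < d) (hn : 0 < n) (j : Fin d) {lam : ℝ}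
    (hlam : Real.cosh lam ≤ 2) (y : Fin d → ℤ) :
    latticeProb d n y ≤ kernelConst d / Real.sqrt n ^ d
      * Real.exp (n * ((Real.cosh lam - 1) / d)) * Real.exp (-lam * y j) := by
  have hd' : (0 : ℝ) < d := by exact_mod_cast hd
  set E := Real.exp (n * ((Real.cosh lam - 1) / d)) * Real.exp (-lam * y j)
  have h1 : (2 * Real.pi) ^ d * latticeProb d n y ≤ ∫ θ, E *
      ∏ i, Real.exp (-(n / (4 * d)) * Real.sin (θ i) ^ 2) ∂(cubeMeasure d) := by
    refine (le_abs_self _).trans ?_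
    have := latticeProb_eq_integral j lam n y
    have h2 : |(2 * Real.pi) ^ d * latticeProb d n y|
        = ‖((2 * Real.pi) ^ d : ℂ) * (latticeProb d n y : ℂ)‖ := by
      rw [← Real.norm_eq_abs, ← Complex.norm_real]
      push_cast
      rfl
    rw [h2, this]
    refine norm_integral_le_of_norm_le (Continuous.integrable_cubeMeasure (by fun_prop))
      (Eventually.of_forall fun θ => ?_)
    rw [norm_mul, norm_pow, norm_latticeExp_tiltedFrequency]
    have h3 := pow_le_pow_left₀ (norm_nonneg _) (norm_stepSymbol_le hd j hlam θ) n
    rw [mul_pow, ← Real.exp_nat_mul, ← Finset.prod_pow] at h3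
    have h4 : ∀ i, Real.exp (-(1 / (4 * d)) * Real.sin (θ i) ^ 2) ^ n
        = Real.exp (-(n / (4 * d)) * Real.sin (θ i) ^ 2) := by
      intro i
      rw [← Real.exp_nat_mul]
      congr 1
      ring
    simp_rw [h4] at h3
    calc _ ≤ _ := mul_le_mul_of_nonneg_right h3 (Real.exp_pos _).le
      _ = _ := by ring
  rw [integral_const_mul] at h1
  have h5 := integral_prod_exp_sin_sq_le hd hn
  have hE : 0 < E := by positivity
  have h6 : (1 : ℝ) ≤ (2 * Real.pi) ^ d := one_le_pow₀ (by linarith [Real.pi_gt_three])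
  have h7 : (2 * Real.pi) ^ d * latticeProb d n y ≤ E * (kernelConst d / Real.sqrt n ^ d) :=
    h1.trans (mul_le_mul_of_nonneg_left h5 hE.le)
  have h8 : 0 ≤ E * (kernelConst d / Real.sqrt n ^ d) :=
    mul_nonneg hE.le (div_nonneg (kernelConst_nonneg d) (by positivity))
  calc latticeProb d n y ≤ E * (kernelConst d / Real.sqrt n ^ d) := by
        by_contra! hcon
        nlinarith
    _ = _ := by ring

/-- Tilt by `1 / √n` with the sign of `y j`. Then `cosh lam - 1 ≤ 1 / n`, so the growth factor over
`n` steps is at most `exp 1`, while the tilt yields the decay in `y j`. -/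
lemma latticeProb_le {d n : ℕ} (hd : 0 < d) (hn : 0 < n) (j : Fin d) (y : Fin d → ℤ) :
    latticeProb d n y ≤ kernelConst d * Real.exp 1 / Real.sqrt n ^ d
      * Real.exp (-|(y j : ℝ)| / Real.sqrt n) := by
  have hd' : (1 : ℝ) ≤ d := by exact_mod_cast hd
  have hn' : (1 : ℝ) ≤ n := by exact_mod_cast hn
  have hs1 : 1 ≤ Real.sqrt n := Real.one_le_sqrt.2 hn'
  have hs0 : 0 < Real.sqrt n := by linarith
  have hss : Real.sqrt n ^ 2 = n := Real.sq_sqrt (by linarith)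
  have hcosh : ∀ lam : ℝ, lam ^ 2 = 1 / n →
      Real.cosh lam - 1 ≤ 1 / n ∧ Real.cosh lam ≤ 2 := by
    intro lam hl
    have h1 := Real.cosh_le_exp_half_sq lam
    have h2 : Real.exp (lam ^ 2 / 2) ≤ 1 + lam ^ 2 := by
      have h3 : lam ^ 2 ≤ 1 := by rw [hl]; exact (div_le_one (by linarith)).2 hn'
      have := Real.exp_bound_div_one_sub_of_interval (x := lam ^ 2 / 2) (by positivity) (by linarith)
      refine this.trans ?_
      rw [div_le_iff₀ (by linarith)]
      nlinarith [sq_nonneg lam]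
    have h3 : 1 / (n : ℝ) ≤ 1 := (div_le_one (by linarith)).2 hn'
    constructor <;> linarith
  have main : ∀ lam : ℝ, lam ^ 2 = 1 / n → -lam * y j = -|(y j : ℝ)| / Real.sqrt n →
      latticeProb d n y ≤ kernelConst d * Real.exp 1 / Real.sqrt n ^ d
      * Real.exp (-|(y j : ℝ)| / Real.sqrt n) := by
    intro lam hl hy
    obtain ⟨h1, h2⟩ := hcosh lam hl
    refine (latticeProb_le_of_tilt hd hn j h2 y).trans ?_
    rw [hy]
    have h3 : n * ((Real.cosh lam - 1) / d) ≤ 1 := by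
      rw [← mul_div_assoc, div_le_one (by linarith)]
      calc n * (Real.cosh lam - 1) ≤ n * (1 / n) := by gcongr
        _ = 1 := by field_simp
        _ ≤ d := hd'
    have h4 := kernelConst_nonneg d
    rw [mul_div_right_comm]
    gcongr
  rcases le_total 0 (y j) with h | h
  · have h' : (0 : ℝ) ≤ y j := by exact_mod_cast h
    refine main (1 / Real.sqrt n) (by rw [div_pow, hss, one_pow]) ?_
    rw [abs_of_nonneg h']
    ring
  · have h' : (y j : ℝ) ≤ 0 := by exact_mod_cast h
    refine main (-(1 / Real.sqrt n)) (by rw [neg_sq, div_pow, hss, one_pow]) ?_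
    rw [abs_of_nonpos h']
    ring

/-! ### Order and linearity of averaging; comparing the torus with lattice images -/

/-- Finite range: `n` averages at `x` see only points within distance `n` in each coordinate. The
local hypothesis is what later lets a finite sum of images stand for the infinite one. -/
lemma iterate_stepAverage_mono {d : ℕ} {f g : (Fin d → ℤ) → ℝ} (n : ℕ) :
    ∀ x : Fin d → ℤ, (∀ w : Fin d → ℤ, (∀ i, |w i - x i| ≤ n) → f w ≤ g w) →
      stepAverage^[n] f x ≤ stepAverage^[n] g x := by
  induction n with
  | zero => intro x h; exact h x (by simp)
  | succ n ih =>
    intro x h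
    rw [Function.iterate_succ_apply', Function.iterate_succ_apply', stepAverage, stepAverage]
    refine mul_le_mul_of_nonneg_left (Finset.sum_le_sum fun i _ => ?_) (by positivity)
    have habs : ∀ k, |(Pi.single i 1 : Fin d → ℤ) k| ≤ 1 := by
      intro k
      rw [Pi.single_apply]
      split_ifs <;> simp
    refine add_le_add (ih _ fun w hw => h w fun k => ?_) (ih _ fun w hw => h w fun k => ?_)
    · have h1 := hw k
      have h2 := habs k
      simp only [Pi.add_apply, abs_le] at h1 h2 ⊢
      push_cast
      omega
    · have h1 := hw k
      have h2 := habs k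
      simp only [Pi.sub_apply, abs_le] at h1 h2 ⊢
      push_cast
      omega

lemma iterate_stepAverage_translate {d : ℕ} (f : (Fin d → ℤ) → ℝ) (v : Fin d → ℤ) (n : ℕ) :
    ∀ x, stepAverage^[n] (fun w => f (w + v)) x = stepAverage^[n] f (x + v) := by
  induction n with
  | zero => intro x; rfl
  | succ n ih =>
    intro x
    rw [Function.iterate_succ_apply', Function.iterate_succ_apply', stepAverage, stepAverage]
    simp_rw [ih]
    congr 1
    refine Finset.sum_congr rfl fun i _ => ?_
    rw [add_right_comm, sub_add_eq_add_sub]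

lemma iterate_stepAverage_sum {d : ℕ} {ι : Type*} (s : Finset ι) (f : ι → (Fin d → ℤ) → ℝ) (n : ℕ) :
    ∀ x, stepAverage^[n] (fun w => ∑ z ∈ s, f z w) x = ∑ z ∈ s, stepAverage^[n] (f z) x := by
  induction n with
  | zero => intro x; rfl
  | succ n ih =>
    intro x
    simp_rw [Function.iterate_succ_apply', stepAverage, ih]
    rw [← Finset.mul_sum, Finset.sum_comm]
    congr 1
    refine Finset.sum_congr rfl fun i _ => ?_
    rw [Finset.sum_add_distrib]

lemma iterate_stepAverage_add {d : ℕ} (f g : (Fin d → ℤ) → ℝ) (n : ℕ) :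
    ∀ x, stepAverage^[n] (fun w => f w + g w) x = stepAverage^[n] f x + stepAverage^[n] g x := by
  intro x
  have := iterate_stepAverage_sum Finset.univ (fun b : Bool => if b then f else g) n x
  simpa using this

lemma iterate_stepAverage_nonneg {d : ℕ} {f : (Fin d → ℤ) → ℝ} (hf : ∀ w, 0 ≤ f w) (n : ℕ)
    (x : Fin d → ℤ) : 0 ≤ stepAverage^[n] f x := by
  have h0 : ∀ n : ℕ, stepAverage^[n] (fun _ : Fin d → ℤ => (0 : ℝ)) = fun _ => 0 := by
    intro n
    induction n with
    | zero => rfl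
    | succ n ih => rw [Function.iterate_succ_apply', ih]; ext y; simp [stepAverage]
  have := iterate_stepAverage_mono (f := fun _ => 0) (g := f) n x fun w _ => hf w
  rwa [h0] at this

lemma latticeProb_nonneg {d : ℕ} (n : ℕ) (y : Fin d → ℤ) : 0 ≤ latticeProb d n y :=
  iterate_stepAverage_nonneg (fun _ => Set.indicator_nonneg (by simp) _) n y

lemma torusProb_nonneg {d L : ℕ} (n : ℕ) (y : Fin d → ℤ) : 0 ≤ torusProb d L n y :=
  iterate_stepAverage_nonneg (fun _ => Set.indicator_nonneg (by simp) _) n y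

/-- Keeping a single nonzero image already bounds the excess from below. -/
lemma latticeProb_add_le_torusProb {d L : ℕ} (hL : 0 < L) {k : Fin d → ℤ} (hk : k ≠ 0)
    (n : ℕ) (x : Fin d → ℤ) :
    latticeProb d n x + latticeProb d n (x + (L : ℤ) • k) ≤ torusProb d L n x := by
  classical
  rw [latticeProb, ← iterate_stepAverage_translate, ← iterate_stepAverage_add, torusProb]
  refine iterate_stepAverage_mono n x fun w _ => ?_
  have hL' : (L : ℤ) ≠ 0 := by exact_mod_cast hL.ne'
  have h0 : (0 : Fin d → ℤ) ∈ multiples d L := fun i => by simp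
  simp only [Set.indicator_apply, Set.mem_singleton_iff, Pi.one_apply]
  by_cases h1 : w = 0
  · subst h1
    have : (0 : Fin d → ℤ) + (L : ℤ) • k ≠ 0 := by
      rw [zero_add]; exact smul_ne_zero hL' hk
    simp only [h0, this, if_true, if_false, add_zero, le_refl]
  · by_cases h2 : w + (L : ℤ) • k = 0
    · have : w ∈ multiples d L := fun i => by
        have := congrFun h2 i
        simp only [Pi.add_apply, Pi.smul_apply, smul_eq_mul, Pi.zero_apply] at this
        exact ⟨-k i, by linarith⟩
      simp only [h1, h2, this, if_true, if_false, zero_add, le_refl]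
    · simp only [h1, h2, if_false, add_zero]
      split_ifs <;> simp

lemma latticeProb_le_torusProb {d L : ℕ} (n : ℕ) (x : Fin d → ℤ) :
    latticeProb d n x ≤ torusProb d L n x := by
  refine iterate_stepAverage_mono n x fun w _ => ?_
  refine Set.indicator_le_indicator_of_subset ?_ (by simp) w
  intro v hv i
  simp [Set.mem_singleton_iff.1 hv]

lemma torusProb_sub_latticeProb_le_sum {d L : ℕ} (hL : 0 < L) (n : ℕ) (x : Fin d → ℤ) :
    ∃ M : ℕ, torusProb d L n x - latticeProb d n x
      ≤ ∑ z ∈ (Fintype.piFinset fun _ : Fin d => Finset.Icc (-M : ℤ) M) \ {0},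
        latticeProb d n (x + (L : ℤ) • z) := by
  classical
  -- A point `L k` reachable from `x` in `n` steps has every `|k i|` at most `n + |x i|`.
  refine ⟨n + ∑ i, (x i).natAbs, ?_⟩
  set M := n + ∑ i, (x i).natAbs with hM
  rw [sub_le_iff_le_add', torusProb]
  have h1 : ∀ z : Fin d → ℤ, latticeProb d n (x + (L : ℤ) • z)
      = stepAverage^[n] (fun w => Set.indicator {0} 1 (w + (L : ℤ) • z)) x := fun z =>
    (iterate_stepAverage_translate _ _ n x).symm
  simp_rw [h1]
  rw [← iterate_stepAverage_sum, latticeProb, ← iterate_stepAverage_add]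
  refine iterate_stepAverage_mono n x fun w hw => ?_
  have hnn : ∀ v : Fin d → ℤ, (0 : ℝ) ≤ Set.indicator {0} 1 v := fun v =>
    Set.indicator_nonneg (by simp) _
  by_cases hmem : w ∈ multiples d L
  · rw [Set.indicator_of_mem hmem]
    by_cases hw0 : w = 0
    · subst hw0
      simp only [Set.indicator_of_mem (Set.mem_singleton _)]
      exact le_add_of_nonneg_right (Finset.sum_nonneg fun z _ => hnn _)
    · choose k hk using hmem
      refine le_add_of_nonneg_of_le (hnn _) ?_
      have hkw : w + (L : ℤ) • (-k) = 0 := by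
        ext i; simp [hk i]
      have hin : -k ∈ (Fintype.piFinset fun _ : Fin d => Finset.Icc (-M : ℤ) M) \ {0} := by
        simp only [Finset.mem_sdiff, Fintype.mem_piFinset, Finset.mem_Icc, Finset.mem_singleton,
          Pi.neg_apply]
        refine ⟨fun i => ?_, fun h0 => hw0 ?_⟩
        · have hi : (x i).natAbs ≤ ∑ i, (x i).natAbs :=
            Finset.single_le_sum (f := fun i => (x i).natAbs) (fun _ _ => Nat.zero_le _)
              (Finset.mem_univ i)
          have h3 := hw i
          have h4 : |k i| ≤ |w i| := by
            rw [hk i, abs_mul]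
            have : (1 : ℤ) ≤ |(L : ℤ)| := by rw [abs_of_nonneg (by positivity)]; exact_mod_cast hL
            nlinarith [abs_nonneg (k i)]
          have h5 : |k i| ≤ (M : ℤ) := by
            rw [hM]
            push_cast [Int.natCast_natAbs]
            have h6 : |w i| ≤ |w i - x i| + |x i| := by
              have := abs_add_le (w i - x i) (x i); simpa using this
            have h7 : |x i| ≤ ∑ i, |x i| :=
              Finset.single_le_sum (f := fun i => |x i|) (fun _ _ => abs_nonneg _)
                (Finset.mem_univ i)
            linarith
          rw [abs_le] at h5
          constructor <;> linarith [h5.1, h5.2]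
        · have : k = 0 := by simpa using h0
          ext i; simp [hk i, this]
      refine le_trans (le_of_eq ?_) (Finset.single_le_sum (fun z _ => hnn _) hin)
      rw [hkw, Set.indicator_of_mem (Set.mem_singleton _)]
      rfl
  · rw [Set.indicator_of_notMem hmem]
    exact add_nonneg (hnn _) (Finset.sum_nonneg fun z _ => hnn _)

/-! ### Times up to `L²`: summing the images -/

lemma sum_pow_natAbs_le {r : ℝ} (hr0 : 0 ≤ r) (hr1 : r < 1) {T : Finset ℤ} (hT : (0 : ℤ) ∉ T) :
    ∑ m ∈ T, r ^ m.natAbs ≤ 2 * r / (1 - r) := by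
  classical
  have hhalf : ∀ U : Finset ℤ, (0 : ℤ) ∉ U → Set.InjOn Int.natAbs (U : Set ℤ) →
      ∑ m ∈ U, r ^ m.natAbs ≤ r / (1 - r) := by
    intro U h0 hU
    rw [← Finset.sum_image (f := fun n : ℕ => r ^ n) hU]
    have h1 : HasSum (fun n : ℕ => r ^ n) (1 - r)⁻¹ := hasSum_geometric_of_lt_one hr0 hr1
    have h0' : (0 : ℕ) ∉ U.image Int.natAbs := by
      intro h
      obtain ⟨m, hm, hm0⟩ := Finset.mem_image.1 h
      rw [Int.natAbs_eq_zero] at hm0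
      exact h0 (hm0 ▸ hm)
    have h2 := sum_le_hasSum (insert 0 (U.image Int.natAbs)) (fun i _ => pow_nonneg hr0 i) h1
    rw [Finset.sum_insert h0', pow_zero] at h2
    have h3 : (1 - r)⁻¹ - 1 = r / (1 - r) := by
      field_simp [(sub_pos.2 hr1).ne']
      ring
    linarith
  rw [← Finset.sum_filter_add_sum_filter_not T (fun m => 0 ≤ m)]
  have e1 := hhalf (T.filter fun m => 0 ≤ m) (by simp [hT]) (by
    intro a ha b hb hab
    simp only [Finset.coe_filter, Set.mem_ofPred_eq] at ha hb
    omega)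
  have e2 := hhalf (T.filter fun m => ¬ 0 ≤ m) (by simp) (by
    intro a ha b hb hab
    simp only [Finset.coe_filter, Set.mem_ofPred_eq] at ha hb
    omega)
  calc _ ≤ r / (1 - r) + r / (1 - r) := add_le_add e1 e2
    _ = _ := by ring

lemma abs_two_mul_le_of_mem_torusBox {d L : ℕ} {x : Fin d → ℤ} (hx : x ∈ torusBox d L)
    (i : Fin d) : 2 * |x i| ≤ L := by
  have := hx i
  have h2 : |x i| = x i ∨ |x i| = -x i := abs_choice _
  split_ifs at this <;> omega

lemma half_mul_le_abs_add {d L : ℕ} {x : Fin d → ℤ} (hx : x ∈ torusBox d L) (z : Fin d → ℤ)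
    (i : Fin d) : |(z i : ℝ)| * L / 2 ≤ |((x + (L : ℤ) • z) i : ℝ)| := by
  have h1 : 2 * |(x i : ℝ)| ≤ L := by exact_mod_cast abs_two_mul_le_of_mem_torusBox hx i
  simp only [Pi.add_apply, Pi.smul_apply, smul_eq_mul, Int.cast_add, Int.cast_mul, Int.cast_natCast]
  have hL : (0 : ℝ) ≤ L := by positivity
  have h2 : |(L : ℝ) * z i| ≤ |(x i : ℝ) + L * z i| + |(x i : ℝ)| := by
    have := abs_sub ((x i : ℝ) + L * z i) (x i)
    simpa using this
  rw [abs_mul, abs_of_nonneg hL] at h2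
  by_cases hz : z i = 0
  · simp [hz]
  · have h3 : (1 : ℝ) ≤ |(z i : ℝ)| := by exact_mod_cast Int.one_le_abs hz
    nlinarith

/-- Put `r = L / √n ≥ 1` and `S = ∑ |z i| ≥ 1`. The largest coordinate of the image is at least `S L
/ (2d)`, and `r + S ≤ 2 S r`, so the kernel decays at least like `exp (-(r + S) / (4d))`. The factor
in `r` pays for `n^(-d/2) = r^d / L^d` through `u^d / d! ≤ exp u`; the factor in `S` is a product of
geometric weights, summable over `z`. -/
lemma latticeProb_translate_le {d : ℕ} (hd : 0 < d) {L n : ℕ} (hL : 0 < L) (hn : 0 < n)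
    (hnL : n ≤ L ^ 2) {x : Fin d → ℤ} (hx : x ∈ torusBox d L) {z : Fin d → ℤ} (hz : z ≠ 0) :
    latticeProb d n (x + (L : ℤ) • z)
      ≤ kernelConst d * Real.exp 1 * ((4 * d) ^ d * d.factorial) / (L : ℝ) ^ d
        * ∏ i, Real.exp (-(1 / (4 * d))) ^ (z i).natAbs := by
  have : Nonempty (Fin d) := ⟨⟨0, hd⟩⟩
  have hd' : (0 : ℝ) < d := by exact_mod_cast hd
  have hL' : (0 : ℝ) < L := by exact_mod_cast hL
  have hn' : (0 : ℝ) < n := by exact_mod_cast hn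
  have hs : 0 < Real.sqrt n := Real.sqrt_pos.2 hn'
  have hsL : Real.sqrt n ≤ L := by
    rw [Real.sqrt_le_left hL'.le]
    exact_mod_cast hnL
  set y := x + (L : ℤ) • z with hy
  obtain ⟨j, -, hj⟩ := Finset.exists_max_image Finset.univ (fun i => |(y i : ℝ)|)
    Finset.univ_nonempty
  set S := ∑ i, |(z i : ℝ)| with hS
  set r := L / Real.sqrt n with hr
  have hr1 : 1 ≤ r := (one_le_div hs).2 hsL
  have hS1 : 1 ≤ S := by
    obtain ⟨i, hi⟩ := Function.ne_iff.1 hz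
    have h1 : (1 : ℝ) ≤ |(z i : ℝ)| := by exact_mod_cast Int.one_le_abs hi
    exact h1.trans (Finset.single_le_sum (f := fun i => |(z i : ℝ)|) (fun _ _ => abs_nonneg _)
      (Finset.mem_univ i))
  have hyj : S * L / 2 ≤ d * |(y j : ℝ)| := by
    calc S * L / 2 = ∑ i, |(z i : ℝ)| * L / 2 := by rw [hS, Finset.sum_mul, Finset.sum_div]
      _ ≤ ∑ _i : Fin d, |(y j : ℝ)| := Finset.sum_le_sum fun i hi =>
          (half_mul_le_abs_add hx z i).trans (hj i hi)
      _ = _ := by simp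
  have hexp : -|(y j : ℝ)| / Real.sqrt n ≤ -(r / (4 * d)) + -(S / (4 * d)) := by
    have h1 : S * r / 2 ≤ d * (|(y j : ℝ)| / Real.sqrt n) := by
      calc S * r / 2 = (S * L / 2) / Real.sqrt n := by rw [hr]; ring
        _ ≤ (d * |(y j : ℝ)|) / Real.sqrt n := by gcongr
        _ = _ := by ring
    have h2 : r + S ≤ 2 * (S * r) := by nlinarith
    have h3 : (r + S) / (4 * d) ≤ |(y j : ℝ)| / Real.sqrt n := by
      rw [div_le_iff₀ (by positivity)]
      nlinarith
    have h4 : (r + S) / (4 * d) = r / (4 * d) + S / (4 * d) := add_div _ _ _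
    rw [neg_div]
    linarith
  have hpow : 1 / Real.sqrt n ^ d
      ≤ (4 * d) ^ d * d.factorial / (L : ℝ) ^ d * Real.exp (r / (4 * d)) := by
    have h1 := Real.pow_div_factorial_le_exp (r / (4 * d)) (by positivity) d
    rw [div_le_iff₀ (by positivity), div_pow, div_le_iff₀ (by positivity)] at h1
    have h2 : 1 / Real.sqrt n ^ d = r ^ d / (L : ℝ) ^ d := by
      rw [hr, div_pow]; field_simp
    rw [h2, div_mul_eq_mul_div]
    gcongr
    linarith
  have hprod : ∏ i, Real.exp (-(1 / (4 * d))) ^ (z i).natAbs = Real.exp (-(S / (4 * d))) := by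
    simp_rw [← Real.exp_nat_mul]
    rw [← Real.exp_sum]
    congr 1
    rw [hS, Finset.sum_div, ← Finset.sum_neg_distrib]
    refine Finset.sum_congr rfl fun i _ => ?_
    rw [Nat.cast_natAbs, Int.cast_abs]
    ring
  rw [hprod]
  have hK := kernelConst_nonneg d
  calc latticeProb d n y ≤ _ := latticeProb_le hd hn j y
    _ = kernelConst d * Real.exp 1 * (1 / Real.sqrt n ^ d) * Real.exp (-|(y j : ℝ)| / Real.sqrt n) := by
        ring
    _ ≤ kernelConst d * Real.exp 1
          * ((4 * d) ^ d * d.factorial / (L : ℝ) ^ d * Real.exp (r / (4 * d)))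
          * Real.exp (-(r / (4 * d)) + -(S / (4 * d))) := by gcongr
    _ = _ := by
        rw [Real.exp_add, Real.exp_neg (r / (4 * d))]
        field_simp

lemma torusProb_sub_latticeProb_le_of_le_sq {d : ℕ} (hd : 0 < d) :
    ∃ K : ℝ, 0 ≤ K ∧ ∀ {L n : ℕ}, 0 < L → n ≤ L ^ 2 → 0 < n → ∀ {x : Fin d → ℤ},
      x ∈ torusBox d L → torusProb d L n x - latticeProb d n x ≤ K / (L : ℝ) ^ d := by
  classical
  set ρ := Real.exp (-(1 / (4 * d))) with hρ
  have hd' : (0 : ℝ) < d := by exact_mod_cast hd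
  have hρ1 : ρ < 1 := Real.exp_lt_one_iff.2 (by rw [neg_lt_zero]; positivity)
  have hρ0 : 0 < ρ := Real.exp_pos _
  have hK := kernelConst_nonneg d
  set A := kernelConst d * Real.exp 1 * ((4 * d) ^ d * d.factorial) with hA
  have hA0 : 0 ≤ A := by positivity
  have hB0 : 0 ≤ 1 + 2 * ρ / (1 - ρ) := by
    have : 0 < 1 - ρ := by linarith
    positivity
  refine ⟨A * (1 + 2 * ρ / (1 - ρ)) ^ d, by positivity, ?_⟩
  intro L n hL hnL hn x hx
  obtain ⟨M, hM⟩ := torusProb_sub_latticeProb_le_sum hL n x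
  refine hM.trans ?_
  have h1D : ∑ m ∈ Finset.Icc (-M : ℤ) M, ρ ^ m.natAbs ≤ 1 + 2 * ρ / (1 - ρ) := by
    have h0 : (0 : ℤ) ∈ Finset.Icc (-M : ℤ) M := by simp
    rw [← Finset.add_sum_erase _ _ h0]
    have := sum_pow_natAbs_le hρ0.le hρ1 (T := (Finset.Icc (-M : ℤ) M).erase 0) (by simp)
    simpa [add_comm] using this
  calc ∑ z ∈ (Fintype.piFinset fun _ : Fin d => Finset.Icc (-M : ℤ) M) \ {0},
        latticeProb d n (x + (L : ℤ) • z)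
      ≤ ∑ z ∈ (Fintype.piFinset fun _ : Fin d => Finset.Icc (-M : ℤ) M) \ {0},
          A / (L : ℝ) ^ d * ∏ i, ρ ^ (z i).natAbs := by
        refine Finset.sum_le_sum fun z hz => ?_
        refine latticeProb_translate_le hd hL hn hnL hx ?_
        simpa using (Finset.mem_sdiff.1 hz).2
    _ ≤ ∑ z ∈ Fintype.piFinset fun _ : Fin d => Finset.Icc (-M : ℤ) M,
          A / (L : ℝ) ^ d * ∏ i, ρ ^ (z i).natAbs := by
        refine Finset.sum_le_sum_of_subset_of_nonneg Finset.sdiff_subset fun z _ _ => ?_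
        positivity
    _ = A / (L : ℝ) ^ d * (∑ m ∈ Finset.Icc (-M : ℤ) M, ρ ^ m.natAbs) ^ d := by
        rw [← Finset.mul_sum, ← Finset.prod_univ_sum (fun _ : Fin d => Finset.Icc (-M : ℤ) M)
          (fun _ m => ρ ^ m.natAbs)]
        simp
    _ ≤ A / (L : ℝ) ^ d * (1 + 2 * ρ / (1 - ρ)) ^ d := by gcongr
    _ = _ := by ring

/-! ### Local central limit theorem for two consecutive times -/

/-- The Fourier symbol of `stepAverage` at a real frequency. -/
noncomputable def realSymbol {d : ℕ} (θ : Fin d → ℝ) : ℝ := (∑ i, Real.cos (θ i)) / d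

lemma stepSymbol_ofReal {d : ℕ} (θ : Fin d → ℝ) :
    stepSymbol (fun i => (θ i : ℂ)) = (realSymbol θ : ℂ) := by
  simp [stepSymbol, realSymbol]

lemma norm_latticeExp_ofReal {d : ℕ} (θ : Fin d → ℝ) (y : Fin d → ℤ) :
    ‖latticeExp (fun i => (θ i : ℂ)) y‖ = 1 := by
  rw [latticeExp, mul_comm]
  have : ∑ i, (θ i : ℂ) * (y i : ℂ) = ((∑ i, θ i * y i : ℝ) : ℂ) := by push_cast; rfl
  rw [this, Complex.norm_exp_ofReal_mul_I]

lemma abs_realSymbol_le_one {d : ℕ} (θ : Fin d → ℝ) : |realSymbol θ| ≤ 1 := by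
  rw [realSymbol, abs_div, Nat.abs_cast]
  refine div_le_one_of_le₀ ?_ (Nat.cast_nonneg d)
  refine (Finset.abs_sum_le_sum_abs _ _).trans ?_
  exact (Finset.sum_le_sum fun i _ => Real.abs_cos_le_one (θ i)).trans (by simp)

lemma one_sub_realSymbol {d : ℕ} (hd : 0 < d) (θ : Fin d → ℝ) :
    1 - realSymbol θ = (∑ i, (1 - Real.cos (θ i))) / d := by
  have hd' : (d : ℝ) ≠ 0 := by exact_mod_cast hd.ne'
  rw [realSymbol, Finset.sum_sub_distrib]
  field_simp
  simp

lemma one_add_realSymbol {d : ℕ} (hd : 0 < d) (θ : Fin d → ℝ) :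
    1 + realSymbol θ = (∑ i, (1 + Real.cos (θ i))) / d := by
  have hd' : (d : ℝ) ≠ 0 := by exact_mod_cast hd.ne'
  rw [realSymbol, Finset.sum_add_distrib]
  field_simp
  simp

lemma continuous_realSymbol {d : ℕ} : Continuous (realSymbol (d := d)) := by
  unfold realSymbol
  fun_prop

/-- Adding consecutive times creates the factor `1 + realSymbol θ`, which vanishes where the symbol
is `-1` and so suppresses the parity oscillation. -/
lemma latticeProb_add_eq_integral {d : ℕ} (hd : 0 < d) (n : ℕ) (y : Fin d → ℤ) :
    ((2 * Real.pi) ^ d : ℂ) * ((latticeProb d n y + latticeProb d (n + 1) y : ℝ) : ℂ)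
      = ∫ θ, ((realSymbol θ ^ n * (1 + realSymbol θ) : ℝ) : ℂ)
          * latticeExp (fun i => (θ i : ℂ)) y ∂(cubeMeasure d) := by
  have h0 : ∀ θ : Fin d → ℝ, tiltedFrequency ⟨0, hd⟩ 0 θ = fun i => (θ i : ℂ) := by
    intro θ; ext i; simp [tiltedFrequency]
  have h := fun m => latticeProb_eq_integral ⟨0, hd⟩ 0 m y
  simp_rw [h0, stepSymbol_ofReal] at h
  have hc : ∀ m : ℕ, Integrable (fun θ : Fin d → ℝ => (realSymbol θ : ℂ) ^ m
      * latticeExp (fun i => (θ i : ℂ)) y) (cubeMeasure d) := fun m => by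
    refine Continuous.integrable_cubeMeasure (((Complex.continuous_ofReal.comp
      continuous_realSymbol).pow m).mul ((continuous_latticeExp y).comp ?_))
    fun_prop
  rw [Complex.ofReal_add, mul_add, h, h, ← integral_add (hc _) (hc _)]
  refine integral_congr_ae (Eventually.of_forall fun θ => ?_)
  push_cast
  ring

lemma max_realSymbol_pow_le {d : ℕ} (hd : 0 < d) (θ : Fin d → ℝ) (n : ℕ) :
    max (realSymbol θ) 0 ^ n ≤ ∏ i, Real.exp (-(n / d) * (1 - Real.cos (θ i))) := by
  have h1 : max (realSymbol θ) 0 ≤ Real.exp (-(1 - realSymbol θ)) := by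
    refine max_le ?_ (Real.exp_pos _).le
    have := Real.add_one_le_exp (-(1 - realSymbol θ))
    linarith
  refine (pow_le_pow_left₀ (le_max_right _ _) h1 n).trans (le_of_eq ?_)
  rw [← Real.exp_nat_mul, one_sub_realSymbol hd, ← Real.exp_sum, ← Finset.mul_sum]
  congr 1
  ring

lemma max_neg_realSymbol_pow_le {d : ℕ} (hd : 0 < d) (θ : Fin d → ℝ) (n : ℕ) :
    max (-realSymbol θ) 0 ^ n ≤ ∏ i, Real.exp (-(n / d) * (1 + Real.cos (θ i))) := by
  have h := max_realSymbol_pow_le hd (fun i => θ i + Real.pi) n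
  have h2 : realSymbol (fun i => θ i + Real.pi) = -realSymbol θ := by
    simp [realSymbol, Real.cos_add_pi, neg_div]
  simpa [h2, Real.cos_add_pi] using h

/-- Where the symbol is negative, put `u = 1 + realSymbol θ`; the term is at most `u exp (-n u)`.
Half of the exponent turns `u` into `2 / n`, the other half leaves a weight whose integral is of
order `n^(-d/2)`. Discarding the negative part thus costs a relative error `O(1 / n)`. -/
lemma abs_realSymbol_pow_sub_max_le {d n : ℕ} (hd : 0 < d) (hn : 0 < n) (θ : Fin d → ℝ) :
    |realSymbol θ ^ n * (1 + realSymbol θ) - max (realSymbol θ) 0 ^ n * (1 + realSymbol θ)|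
      ≤ 2 / n * ∏ i, Real.exp (-(n / (4 * d)) * Real.sin (θ i) ^ 2) := by
  have hd' : (0 : ℝ) < d := by exact_mod_cast hd
  have hn' : (0 : ℝ) < n := by exact_mod_cast hn
  rcases le_total 0 (realSymbol θ) with h | h
  · rw [max_eq_left h, sub_self, abs_zero]
    positivity
  · rw [max_eq_right h, zero_pow hn.ne', zero_mul, sub_zero, abs_mul, abs_pow, abs_of_nonpos h]
    set u := 1 + realSymbol θ with hu
    have hu0 : 0 ≤ u := by linarith [(abs_le.1 (abs_realSymbol_le_one θ)).1]
    have h1 : -realSymbol θ ≤ Real.exp (-u) := by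
      have := Real.add_one_le_exp (-u)
      linarith
    have h2 : (-realSymbol θ) ^ n ≤ Real.exp (-(n * u / 2)) * Real.exp (-(n * u / 2)) := by
      refine (pow_le_pow_left₀ (by linarith) h1 n).trans (le_of_eq ?_)
      rw [← Real.exp_nat_mul, ← Real.exp_add]
      congr 1; ring
    have h3 : Real.exp (-(n * u / 2)) * u ≤ 2 / n := by
      have := Real.add_one_le_exp (n * u / 2)
      rw [Real.exp_neg, inv_mul_le_iff₀ (Real.exp_pos _)]
      calc u = (n * u / 2) * (2 / n) := by field_simp
        _ ≤ _ := by gcongr; linarith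
    have h4 : Real.exp (-(n * u / 2)) ≤ ∏ i, Real.exp (-(n / (4 * d)) * Real.sin (θ i) ^ 2) := by
      rw [← Real.exp_sum, Real.exp_le_exp, ← Finset.mul_sum, hu, one_add_realSymbol hd]
      have h5 : ∑ i, Real.sin (θ i) ^ 2 ≤ 2 * ∑ i, (1 + Real.cos (θ i)) := by
        rw [Finset.mul_sum]
        refine Finset.sum_le_sum fun i _ => ?_
        nlinarith [Real.sin_sq_add_cos_sq (θ i), Real.neg_one_le_cos (θ i), Real.cos_le_one (θ i)]
      have h6 : n / (4 * d) * ∑ i, Real.sin (θ i) ^ 2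
          ≤ n / (4 * d) * (2 * ∑ i, (1 + Real.cos (θ i))) := by gcongr
      have h7 : n / (4 * d) * (2 * ∑ i, (1 + Real.cos (θ i)))
          = n * ((∑ i, (1 + Real.cos (θ i))) / d) / 2 := by field_simp; ring
      linarith
    rw [abs_of_nonneg hu0]
    calc (-realSymbol θ) ^ n * u
        ≤ Real.exp (-(n * u / 2)) * Real.exp (-(n * u / 2)) * u := by gcongr
      _ = (Real.exp (-(n * u / 2)) * u) * Real.exp (-(n * u / 2)) := by ring
      _ ≤ _ := by gcongr

/-- The part of the Fourier transform of two consecutive walk distributions that concentrates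
at the origin, on the scale `√n`. -/
noncomputable def scaledSymbol (d n : ℕ) (t : Fin d → ℝ) : ℝ :=
  Set.indicator (Set.Icc (fun _ => -Real.pi) (fun _ => Real.pi))
    (fun θ : Fin d → ℝ => max (realSymbol θ) 0 ^ n * (1 + realSymbol θ)) ((Real.sqrt n)⁻¹ • t)

lemma integrable_exp_neg_mul_sum_sq (d : ℕ) {b : ℝ} (hb : 0 < b) :
    Integrable (fun t : Fin d → ℝ => Real.exp (-b * ∑ i, t i ^ 2)) := by
  have h := Integrable.fintype_prod (μ := fun _ : Fin d => (volume : Measure ℝ))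
    (f := fun _ t => Real.exp (-b * t ^ 2)) fun _ => integrable_exp_neg_mul_sq hb
  simp_rw [← Real.exp_sum, ← Finset.mul_sum] at h
  exact h

lemma measurable_scaledSymbol (d n : ℕ) : Measurable (scaledSymbol d n) := by
  unfold scaledSymbol
  have h : Continuous (fun θ : Fin d → ℝ => max (realSymbol θ) 0 ^ n * (1 + realSymbol θ)) :=
    ((continuous_realSymbol.max continuous_const).pow n).mul
      (continuous_const.add continuous_realSymbol)
  exact (h.measurable.indicator measurableSet_Icc).comp (measurable_const_smul _)

/-- A Gaussian majorant independent of `n`, from `1 - cos θ ≥ 2 θ² / π²` on `[-π, π]`; this is why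
the symbol is cut off to the cube. -/
lemma abs_scaledSymbol_le {d n : ℕ} (hd : 0 < d) (hn : 0 < n) (t : Fin d → ℝ) :
    |scaledSymbol d n t| ≤ 2 * Real.exp (-(2 / (Real.pi ^ 2 * d)) * ∑ i, t i ^ 2) := by
  have hd' : (0 : ℝ) < d := by exact_mod_cast hd
  have hn' : (0 : ℝ) < n := by exact_mod_cast hn
  have hpi := Real.pi_pos
  set θ := (Real.sqrt n)⁻¹ • t with hθ
  rw [scaledSymbol, ← hθ]
  by_cases h : θ ∈ Set.Icc (fun _ : Fin d => -Real.pi) (fun _ => Real.pi)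
  · rw [Set.indicator_of_mem h]
    have hs := abs_le.1 (abs_realSymbol_le_one θ)
    rw [abs_of_nonneg (mul_nonneg (pow_nonneg (le_max_right _ _) n) (by linarith)), mul_comm]
    refine mul_le_mul (by linarith) ?_ (pow_nonneg (le_max_right _ _) n) (by norm_num)
    refine (max_realSymbol_pow_le hd θ n).trans ?_
    rw [← Real.exp_sum, Real.exp_le_exp, Finset.mul_sum]
    refine Finset.sum_le_sum fun i _ => ?_
    have h1 := Real.cos_le_one_sub_mul_cos_sq (x := θ i) (abs_le.2 ⟨h.1 i, h.2 i⟩)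
    have h2 : θ i ^ 2 = t i ^ 2 / n := by
      simp only [hθ, Pi.smul_apply, smul_eq_mul, mul_pow, inv_pow]
      rw [Real.sq_sqrt hn'.le]
      ring
    rw [h2] at h1
    have h3 : n / d * (2 / Real.pi ^ 2 * (t i ^ 2 / n)) ≤ n / d * (1 - Real.cos (θ i)) := by
      gcongr; linarith
    have h4 : n / d * (2 / Real.pi ^ 2 * (t i ^ 2 / n)) = 2 / (Real.pi ^ 2 * d) * t i ^ 2 := by
      field_simp
    linarith
  · rw [Set.indicator_of_notMem h, abs_zero]
    positivity

lemma tendsto_mul_cos_sub_one (t : ℝ) :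
    Tendsto (fun n : ℕ => (n : ℝ) * (Real.cos ((Real.sqrt n)⁻¹ * t) - 1)) atTop
      (nhds (-(t ^ 2 / 2))) := by
  have hs : Tendsto (fun n : ℕ => Real.sqrt n) atTop atTop :=
    Real.tendsto_sqrt_atTop.comp tendsto_natCast_atTop_atTop
  have hx : Tendsto (fun n : ℕ => (Real.sqrt n)⁻¹ * t) atTop (nhds 0) := by
    simpa using (tendsto_inv_atTop_zero.comp hs).mul_const t
  have hx1 : ∀ᶠ n : ℕ in atTop, |(Real.sqrt n)⁻¹ * t| ≤ 1 := by
    have := hx.abs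
    rw [abs_zero] at this
    exact this.eventually_le_const zero_lt_one
  have hlim : Tendsto (fun n : ℕ => t ^ 4 * (5 / 96) / (n : ℝ)) atTop (nhds 0) :=
    tendsto_const_nhds.div_atTop tendsto_natCast_atTop_atTop
  rw [tendsto_iff_norm_sub_tendsto_zero]
  refine squeeze_zero' (Eventually.of_forall fun _ => norm_nonneg _) ?_ hlim
  filter_upwards [hx1, eventually_gt_atTop 0] with n hn hn0
  have hn' : (0 : ℝ) < n := by exact_mod_cast hn0
  have h1 := Real.cos_bound hn
  set x := (Real.sqrt n)⁻¹ * t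
  have h2 : x ^ 2 = t ^ 2 / n := by
    simp only [x, mul_pow, inv_pow]
    rw [Real.sq_sqrt hn'.le]; ring
  have h3 : |x| ^ 4 = t ^ 4 / (n : ℝ) ^ 2 := by
    rw [show |x| ^ 4 = (|x| ^ 2) ^ 2 by ring, sq_abs, h2]; ring
  rw [h2, h3] at h1
  rw [Real.norm_eq_abs]
  have h4 : (n : ℝ) * (Real.cos x - 1) - -(t ^ 2 / 2)
      = n * (Real.cos x - (1 - t ^ 2 / n / 2)) := by field_simp; ring
  rw [h4, abs_mul, abs_of_pos hn']
  calc n * |Real.cos x - (1 - t ^ 2 / n / 2)| ≤ n * (t ^ 4 / (n : ℝ) ^ 2 * (5 / 96)) := by gcongr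
    _ = _ := by field_simp

lemma tendsto_scaledSymbol {d : ℕ} (hd : 0 < d) (t : Fin d → ℝ) :
    Tendsto (fun n => scaledSymbol d n t) atTop
      (nhds (2 * Real.exp (-(1 / (2 * d)) * ∑ i, t i ^ 2))) := by
  have hd' : (0 : ℝ) < d := by exact_mod_cast hd
  set s : ℕ → ℝ := fun n => realSymbol ((Real.sqrt n)⁻¹ • t) with hs
  have hsq : Tendsto (fun n : ℕ => (Real.sqrt n)⁻¹) atTop (nhds 0) :=
    tendsto_inv_atTop_zero.comp (Real.tendsto_sqrt_atTop.comp tendsto_natCast_atTop_atTop)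
  have hθ : Tendsto (fun n : ℕ => (Real.sqrt n)⁻¹ • t) atTop (nhds 0) := by
    simpa using hsq.smul_const t
  have hs1 : Tendsto s atTop (nhds 1) := by
    have h := (continuous_realSymbol.tendsto (0 : Fin d → ℝ)).comp hθ
    have h0 : realSymbol (0 : Fin d → ℝ) = 1 := by
      simp [realSymbol, hd'.ne']
    rwa [h0] at h
  have hmul : Tendsto (fun n : ℕ => (n : ℝ) * (s n - 1)) atTop
      (nhds (-(1 / (2 * d)) * ∑ i, t i ^ 2)) := by
    have h := (tendsto_finsetSum Finset.univ fun i _ => tendsto_mul_cos_sub_one (t i)).div_const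
      (d : ℝ)
    have e1 : (∑ i, -(t i ^ 2 / 2)) / d = -(1 / (2 * d)) * ∑ i, t i ^ 2 := by
      rw [Finset.sum_neg_distrib, ← Finset.sum_div]
      field_simp
    rw [e1] at h
    refine h.congr fun n => ?_
    have h2 := one_sub_realSymbol hd ((Real.sqrt n)⁻¹ • t)
    have h3 : s n - 1 = -((∑ i, (1 - Real.cos ((Real.sqrt n)⁻¹ * t i))) / d) := by
      rw [← neg_sub]; exact congrArg Neg.neg h2
    rw [h3, ← Finset.mul_sum, Finset.sum_sub_distrib, Finset.sum_sub_distrib]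
    ring
  have hpow : Tendsto (fun n => s n ^ n) atTop
      (nhds (Real.exp (-(1 / (2 * d)) * ∑ i, t i ^ 2))) := by
    have := Real.tendsto_one_add_pow_exp_of_tendsto hmul
    simpa using this
  have hfin := hpow.mul (hs1.const_add 1)
  rw [one_add_one_eq_two, mul_comm] at hfin
  refine hfin.congr' ?_
  have hmem : ∀ᶠ n : ℕ in atTop, (Real.sqrt n)⁻¹ • t
      ∈ Set.Icc (fun _ : Fin d => -Real.pi) (fun _ => Real.pi) := by
    refine hθ.eventually_mem ?_
    rw [← Set.pi_univ_Icc]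
    exact set_pi_mem_nhds Set.finite_univ fun i _ =>
      Icc_mem_nhds (neg_lt_zero.2 Real.pi_pos) Real.pi_pos
  filter_upwards [hmem, hs1.eventually_const_le one_half_lt_one] with n h1 h2
  rw [scaledSymbol, Set.indicator_of_mem h1]
  have h3 : 0 ≤ s n := by linarith
  simp only [hs] at h3 ⊢
  rw [max_eq_left h3]

/-- Convergence in `L¹` is the useful form: the exponentials have modulus one, so the resulting
kernel error is uniform in `y`. -/
lemma tendsto_integral_scaledSymbol {d : ℕ} (hd : 0 < d) :
    Tendsto (fun n => ∫ t, |scaledSymbol d n t - 2 * Real.exp (-(1 / (2 * d)) * ∑ i, t i ^ 2)|)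
      atTop (nhds 0) := by
  have hd' : (0 : ℝ) < d := by exact_mod_cast hd
  have hpi := Real.pi_pos
  have hm : ∀ n, Measurable (fun t : Fin d → ℝ =>
      scaledSymbol d n t - 2 * Real.exp (-(1 / (2 * d)) * ∑ i, t i ^ 2)) := fun n =>
    (measurable_scaledSymbol d n).sub (by fun_prop)
  have h := tendsto_integral_filter_of_dominated_convergence (μ := volume) (l := atTop)
    (F := fun n t => |scaledSymbol d n t - 2 * Real.exp (-(1 / (2 * d)) * ∑ i, t i ^ 2)|)
    (f := fun _ => (0 : ℝ))
    (fun t : Fin d → ℝ => 2 * Real.exp (-(2 / (Real.pi ^ 2 * d)) * ∑ i, t i ^ 2)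
      + 2 * Real.exp (-(1 / (2 * d)) * ∑ i, t i ^ 2))
    (Eventually.of_forall fun n => ((hm n).abs).aestronglyMeasurable)
    (by
      filter_upwards [eventually_gt_atTop 0] with n hn
      refine Eventually.of_forall fun t => ?_
      rw [Real.norm_eq_abs, abs_abs]
      refine (abs_sub _ _).trans (add_le_add (abs_scaledSymbol_le hd hn t) (le_of_eq ?_))
      exact abs_of_pos (by positivity))
    (((integrable_exp_neg_mul_sum_sq d (by positivity)).const_mul 2).add
      ((integrable_exp_neg_mul_sum_sq d (by positivity)).const_mul 2))
    (Eventually.of_forall fun t => by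
      have := ((tendsto_scaledSymbol hd t).sub_const
        (2 * Real.exp (-(1 / (2 * d)) * ∑ i, t i ^ 2))).abs
      simpa using this)
  simpa using h

lemma integral_gaussian_mul_latticeExp {d n : ℕ} (hd : 0 < d) (hn : 0 < n) (y : Fin d → ℤ) :
    ∫ t : Fin d → ℝ, ((2 * Real.exp (-(1 / (2 * d)) * ∑ i, t i ^ 2) : ℝ) : ℂ)
        * latticeExp (fun i => (((Real.sqrt n)⁻¹ • t) i : ℂ)) y
      = ((2 * ((2 * Real.pi * d) ^ ((d : ℝ) / 2)
          * Real.exp (-(d / 2 * ((∑ i, (y i : ℝ) ^ 2) / n)))) : ℝ) : ℂ) := by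
  have hd' : (0 : ℝ) < d := by exact_mod_cast hd
  have hn' : (0 : ℝ) < n := by exact_mod_cast hn
  have hb : 0 < ((1 / (2 * d) : ℝ) : ℂ).re := by
    rw [Complex.ofReal_re]; positivity
  have h := GaussianFourier.integral_cexp_neg_mul_sum_add hb
    (fun i : Fin d => Complex.I * ((Real.sqrt n)⁻¹ * y i : ℝ))
  have h2 : ∀ t : Fin d → ℝ, ((2 * Real.exp (-(1 / (2 * d)) * ∑ i, t i ^ 2) : ℝ) : ℂ)
        * latticeExp (fun i => (((Real.sqrt n)⁻¹ • t) i : ℂ)) y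
      = 2 * Complex.exp (-((1 / (2 * d) : ℝ) : ℂ) * ∑ i, (t i : ℂ) ^ 2
          + ∑ i, Complex.I * ((Real.sqrt n)⁻¹ * y i : ℝ) * t i) := by
    intro t
    have e : Complex.I * ∑ i, (((Real.sqrt n)⁻¹ • t) i : ℂ) * (y i : ℂ)
        = ∑ i, Complex.I * ((Real.sqrt n)⁻¹ * y i : ℝ) * t i := by
      rw [Finset.mul_sum]
      refine Finset.sum_congr rfl fun i _ => ?_
      simp only [Pi.smul_apply, smul_eq_mul]
      push_cast
      ring
    rw [Complex.exp_add, latticeExp, e]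
    push_cast
    ring
  simp_rw [h2]
  rw [integral_const_mul, h]
  have hpow : ((Real.pi : ℂ) / ((1 / (2 * d) : ℝ) : ℂ)) ^ ((Fintype.card (Fin d) : ℂ) / 2)
      = (((2 * Real.pi * d) ^ ((d : ℝ) / 2) : ℝ) : ℂ) := by
    rw [Complex.ofReal_cpow (by positivity), Fintype.card_fin]
    congr 1
    · push_cast
      field_simp
    · push_cast; rfl
  have hsum : (∑ i : Fin d, (Complex.I * ((Real.sqrt n)⁻¹ * y i : ℝ)) ^ 2)
      / (4 * ((1 / (2 * d) : ℝ) : ℂ)) = ((-(d / 2 * ((∑ i, (y i : ℝ) ^ 2) / n)) : ℝ) : ℂ) := by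
    have e1 : ∀ i : Fin d, (Complex.I * (((Real.sqrt n)⁻¹ * y i : ℝ) : ℂ)) ^ 2
        = ((-((y i : ℝ) ^ 2 / n) : ℝ) : ℂ) := by
      intro i
      rw [mul_pow, Complex.I_sq, ← Complex.ofReal_pow, mul_pow, inv_pow, Real.sq_sqrt hn'.le]
      push_cast
      ring
    rw [Finset.sum_congr rfl fun i _ => e1 i, ← Complex.ofReal_sum, Finset.sum_neg_distrib,
      ← Finset.sum_div]
    push_cast
    field_simp
    ring
  rw [hpow, hsum]
  push_cast
  ring

lemma exists_le_latticeProb_add {d : ℕ} (hd : 0 < d) :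
    ∃ ε : ℕ → ℝ, Tendsto ε atTop (nhds 0) ∧ ∀ {n : ℕ}, 0 < n → ∀ y : Fin d → ℤ,
      2 * ((2 * Real.pi * d) ^ ((d : ℝ) / 2) * Real.exp (-(d / 2 * ((∑ i, (y i : ℝ) ^ 2) / n))))
        - ε n ≤ (2 * Real.pi) ^ d * Real.sqrt n ^ d
          * (latticeProb d n y + latticeProb d (n + 1) y) := by
  have hd' : (0 : ℝ) < d := by exact_mod_cast hd
  -- The first term comes from discarding the negative part of the symbol, the second from replacing
  -- the rescaled symbol by its Gaussian limit.
  refine ⟨fun n => 2 * kernelConst d / n + ∫ t, |scaledSymbol d n t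
    - 2 * Real.exp (-(1 / (2 * d)) * ∑ i, t i ^ 2)|, ?_, ?_⟩
  · have h1 : Tendsto (fun n : ℕ => 2 * kernelConst d / n) atTop (nhds 0) :=
      tendsto_const_nhds.div_atTop tendsto_natCast_atTop_atTop
    simpa using h1.add (tendsto_integral_scaledSymbol hd)
  intro n hn y
  have hn' : (0 : ℝ) < n := by exact_mod_cast hn
  have hs : 0 < Real.sqrt n := Real.sqrt_pos.2 hn'
  set X : (Fin d → ℝ) → ℂ := fun θ => latticeExp (fun i => (θ i : ℂ)) y with hX
  have hXc : Continuous X := (continuous_latticeExp y).comp (by fun_prop)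
  have hX1 : ∀ θ, ‖X θ‖ = 1 := fun θ => norm_latticeExp_ofReal θ y
  set g : (Fin d → ℝ) → ℝ := fun θ => realSymbol θ ^ n * (1 + realSymbol θ) with hg
  set g' : (Fin d → ℝ) → ℝ := fun θ => max (realSymbol θ) 0 ^ n * (1 + realSymbol θ) with hg'
  have hgc : Continuous g :=
    (continuous_realSymbol.pow n).mul (continuous_const.add continuous_realSymbol)
  have hgc' : Continuous g' := ((continuous_realSymbol.max continuous_const).pow n).mul
      (continuous_const.add continuous_realSymbol)
  set B : (Fin d → ℝ) → ℝ := fun t => 2 * Real.exp (-(1 / (2 * d)) * ∑ i, t i ^ 2) with hB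
  have hBi : Integrable B := (integrable_exp_neg_mul_sum_sq d (by positivity)).const_mul 2
  have hSi : Integrable (scaledSymbol d n) :=
    ((integrable_exp_neg_mul_sum_sq d (b := 2 / (Real.pi ^ 2 * d)) (by
      have := Real.pi_pos; positivity)).const_mul 2).mono'
      (measurable_scaledSymbol d n).aestronglyMeasurable
      (Eventually.of_forall fun t => abs_scaledSymbol_le hd hn t)
  have hXs : Continuous (fun t : Fin d → ℝ => X ((Real.sqrt n)⁻¹ • t)) :=
    hXc.comp (continuous_const_smul _)
  have hmulX : ∀ {f : (Fin d → ℝ) → ℝ}, Integrable f →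
      Integrable (fun t => (f t : ℂ) * X ((Real.sqrt n)⁻¹ • t)) := fun hf =>
    hf.ofReal.mul_bdd hXs.aestronglyMeasurable (Eventually.of_forall fun t => (hX1 _).le)
  have hmain : ((2 * Real.pi) ^ d : ℂ) * ((latticeProb d n y + latticeProb d (n + 1) y : ℝ) : ℂ)
      = ∫ θ, (g θ : ℂ) * X θ ∂(cubeMeasure d) := latticeProb_add_eq_integral hd n y
  have hsmall : ‖(∫ θ, (g θ : ℂ) * X θ ∂(cubeMeasure d)) - ∫ θ, (g' θ : ℂ) * X θ ∂(cubeMeasure d)‖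
      ≤ 2 / n * (kernelConst d / Real.sqrt n ^ d) := by
    rw [← integral_sub (Continuous.integrable_cubeMeasure (by fun_prop))
      (Continuous.integrable_cubeMeasure (by fun_prop))]
    have h1 := norm_integral_le_of_norm_le (μ := cubeMeasure d)
      (f := fun θ => (g θ : ℂ) * X θ - (g' θ : ℂ) * X θ)
      (g := fun θ => 2 / n * ∏ i, Real.exp (-(n / (4 * d)) * Real.sin (θ i) ^ 2))
      (Continuous.integrable_cubeMeasure (by fun_prop)) (Eventually.of_forall fun θ => by
        rw [← sub_mul, norm_mul, hX1, mul_one, ← Complex.ofReal_sub, Complex.norm_real]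
        exact abs_realSymbol_pow_sub_max_le hd hn θ)
    rw [integral_const_mul] at h1
    exact h1.trans (by gcongr; exact integral_prod_exp_sin_sq_le hd hn)
  -- Substitution `θ = t / √n`.
  have hscale : ((Real.sqrt n ^ d : ℝ) : ℂ) * ∫ θ, (g' θ : ℂ) * X θ ∂(cubeMeasure d)
      = ∫ t, (scaledSymbol d n t : ℂ) * X ((Real.sqrt n)⁻¹ • t) := by
    set cube : Set (Fin d → ℝ) := Set.Icc (fun _ => -Real.pi) (fun _ => Real.pi)
    have h1 := Measure.integral_comp_smul (volume : Measure (Fin d → ℝ))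
      (fun θ => ((cube.indicator g' θ : ℝ) : ℂ) * X θ) (Real.sqrt n)⁻¹
    have h2 : ∫ t, (scaledSymbol d n t : ℂ) * X ((Real.sqrt n)⁻¹ • t)
        = ∫ t, (fun θ => ((cube.indicator g' θ : ℝ) : ℂ) * X θ) ((Real.sqrt n)⁻¹ • t) := rfl
    rw [h2, h1, Module.finrank_fin_fun, inv_pow, inv_inv, abs_of_pos (by positivity),
      Complex.real_smul, cubeMeasure_eq, ← integral_indicator measurableSet_Icc]
    congr 2
    ext θ
    by_cases hθ : θ ∈ cube <;> simp [cube, hθ, Set.indicator_of_mem, Set.indicator_of_notMem]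
  have hclose : ‖(∫ t, (scaledSymbol d n t : ℂ) * X ((Real.sqrt n)⁻¹ • t))
      - ∫ t, (B t : ℂ) * X ((Real.sqrt n)⁻¹ • t)‖ ≤ ∫ t, |scaledSymbol d n t - B t| := by
    rw [← integral_sub (hmulX hSi) (hmulX hBi)]
    refine norm_integral_le_of_norm_le (hSi.sub hBi).abs (Eventually.of_forall fun t => ?_)
    rw [← sub_mul, norm_mul, hX1, mul_one, ← Complex.ofReal_sub, Complex.norm_real,
      Real.norm_eq_abs]
  have hgauss := integral_gaussian_mul_latticeExp hd hn y
  set V : ℝ := 2 * ((2 * Real.pi * d) ^ ((d : ℝ) / 2)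
          * Real.exp (-(d / 2 * ((∑ i, (y i : ℝ) ^ 2) / n)))) with hV
  set p := latticeProb d n y + latticeProb d (n + 1) y with hp
  set J := ∫ t, |scaledSymbol d n t - B t| with hJ
  have hfinal : ‖(((2 * Real.pi) ^ d * Real.sqrt n ^ d * p - V : ℝ) : ℂ)‖
      ≤ 2 * kernelConst d / n + J := by
    have e : (((2 * Real.pi) ^ d * Real.sqrt n ^ d * p - V : ℝ) : ℂ)
        = ((Real.sqrt n ^ d : ℝ) : ℂ) * ((∫ θ, (g θ : ℂ) * X θ ∂(cubeMeasure d))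
            - ∫ θ, (g' θ : ℂ) * X θ ∂(cubeMeasure d))
          + ((∫ t, (scaledSymbol d n t : ℂ) * X ((Real.sqrt n)⁻¹ • t))
            - ∫ t, (B t : ℂ) * X ((Real.sqrt n)⁻¹ • t)) := by
      have hgauss' : ∫ t, (B t : ℂ) * X ((Real.sqrt n)⁻¹ • t) = (V : ℂ) := hgauss
      rw [mul_sub, hscale, ← hmain, hgauss']
      push_cast
      ring
    rw [e]
    refine (norm_add_le _ _).trans (add_le_add ?_ hclose)
    rw [norm_mul, Complex.norm_real, Real.norm_eq_abs, abs_of_pos (by positivity)]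
    calc Real.sqrt n ^ d * _ ≤ Real.sqrt n ^ d * (2 / n * (kernelConst d / Real.sqrt n ^ d)) := by
          gcongr
      _ = _ := by field_simp
  rw [Complex.norm_real, Real.norm_eq_abs] at hfinal
  linarith [(abs_le.1 hfinal).1]

lemma exists_const_le_latticeProb_add {d : ℕ} (hd : 0 < d) (A : ℝ) :
    ∃ c > (0 : ℝ), ∃ n₀ : ℕ, ∀ {n : ℕ}, n₀ ≤ n → ∀ {y : Fin d → ℤ},
      ∑ i, (y i : ℝ) ^ 2 ≤ A * n →
      c / Real.sqrt n ^ d ≤ latticeProb d n y + latticeProb d (n + 1) y := by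
  have hd' : (0 : ℝ) < d := by exact_mod_cast hd
  have hpi := Real.pi_pos
  obtain ⟨ε, hε, hle⟩ := exists_le_latticeProb_add hd
  set c₀ := (2 * Real.pi * d) ^ ((d : ℝ) / 2) * Real.exp (-(d / 2 * A)) with hc
  have hc0 : 0 < c₀ := by positivity
  -- The main term is at least `2 c₀`; once the error is at most `c₀`, a full `c₀` survives.
  obtain ⟨n₀, hn₀⟩ := eventually_atTop.1 (hε.eventually_le_const hc0)
  refine ⟨c₀ / (2 * Real.pi) ^ d, by positivity, max n₀ 1, ?_⟩
  intro n hn y hy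
  have hn1 : 0 < n := lt_of_lt_of_le one_pos ((le_max_right _ _).trans hn)
  have hn' : (0 : ℝ) < n := by exact_mod_cast hn1
  have hs : 0 < Real.sqrt n := Real.sqrt_pos.2 hn'
  have h1 := hle hn1 y
  have h2 := hn₀ n ((le_max_left _ _).trans hn)
  have h3 : c₀ ≤ (2 * Real.pi * d) ^ ((d : ℝ) / 2)
      * Real.exp (-(d / 2 * ((∑ i, (y i : ℝ) ^ 2) / n))) := by
    rw [hc]
    gcongr
    rwa [div_le_iff₀ hn']
  rw [div_div, div_le_iff₀ (by positivity)]
  linarith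

/-! ### Times beyond `L²`: discrete Fourier analysis on the torus -/

lemma iterate_stepAverage_eq_sum {d : ℕ} {ι : Type*} (s : Finset ι) {ζ : ι → Fin d → ℂ}
    {f : (Fin d → ℤ) → ℝ} {a : ℂ} (h0 : ∀ y, a * (f y : ℂ) = ∑ k ∈ s, latticeExp (ζ k) y) (n : ℕ) :
    ∀ y, a * ((stepAverage^[n] f y : ℝ) : ℂ)
      = ∑ k ∈ s, stepSymbol (ζ k) ^ n * latticeExp (ζ k) y := by
  induction n with
  | zero => intro y; simpa using h0 y
  | succ n ih =>
    intro y
    rw [Function.iterate_succ_apply', ofReal_stepAverage, mul_left_comm, Finset.mul_sum]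
    simp_rw [mul_add, ih, ← Finset.sum_add_distrib]
    rw [Finset.sum_comm, Finset.mul_sum]
    refine Finset.sum_congr rfl fun k _ => ?_
    rw [pow_succ, mul_assoc, ← sum_latticeExp_neighbours]
    simp_rw [← mul_add]
    rw [← Finset.mul_sum]
    ring

/-- The frequencies dual to the torus of side length `L`. -/
noncomputable def dualFrequency {d : ℕ} (L : ℕ) (k : Fin d → ℕ) : Fin d → ℝ :=
  fun i => 2 * Real.pi * k i / L

lemma sum_exp_dualFrequency {L : ℕ} (hL : 0 < L) (m : ℤ) :
    ∑ j ∈ Finset.range L, Complex.exp (Complex.I * (((2 * Real.pi * j / L : ℝ) : ℂ) * m))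
      = if (L : ℤ) ∣ m then (L : ℂ) else 0 := by
  have hL' : (L : ℂ) ≠ 0 := by exact_mod_cast hL.ne'
  set w := Complex.exp (2 * Real.pi * Complex.I * (m / L)) with hw
  have h : ∀ j : ℕ, Complex.exp (Complex.I * (((2 * Real.pi * j / L : ℝ) : ℂ) * m)) = w ^ j := by
    intro j
    rw [hw, ← Complex.exp_nat_mul]
    congr 1
    push_cast
    ring
  simp_rw [h]
  split_ifs with hm
  · obtain ⟨q, rfl⟩ := hm
    have : w = 1 := by
      rw [hw, Complex.exp_eq_one_iff]
      refine ⟨q, ?_⟩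
      push_cast
      field_simp
    simp [this]
  · have hw1 : w - 1 ≠ 0 := by
      intro h1
      rw [sub_eq_zero, hw, Complex.exp_eq_one_iff] at h1
      obtain ⟨q, hq⟩ := h1
      apply hm
      have hpi : (2 * Real.pi * Complex.I : ℂ) ≠ 0 := Complex.two_pi_I_ne_zero
      have h2 : (m / L : ℂ) = q := by
        apply mul_left_cancel₀ hpi
        rw [hq]; ring
      rw [div_eq_iff hL'] at h2
      refine ⟨q, ?_⟩
      have : (m : ℂ) = ((L * q : ℤ) : ℂ) := by rw [h2]; push_cast; ring
      exact_mod_cast this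
    have hwL : w ^ L = 1 := by
      rw [hw, ← Complex.exp_nat_mul, Complex.exp_eq_one_iff]
      exact ⟨m, by field_simp⟩
    have h3 := mul_geom_sum w L
    rw [hwL, sub_self] at h3
    exact (mul_eq_zero.1 h3).resolve_left hw1

lemma torusProb_eq_sum {d L : ℕ} (hL : 0 < L) (n : ℕ) (y : Fin d → ℤ) :
    ((L : ℂ) ^ d) * (torusProb d L n y : ℂ)
      = ∑ k ∈ Fintype.piFinset fun _ : Fin d => Finset.range L,
          (realSymbol (dualFrequency L k) : ℂ) ^ n
            * latticeExp (fun i => (dualFrequency L k i : ℂ)) y := by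
  classical
  have h := iterate_stepAverage_eq_sum (Fintype.piFinset fun _ : Fin d => Finset.range L)
    (ζ := fun k i => (dualFrequency L k i : ℂ)) (f := Set.indicator (multiples d L) 1)
    (a := (L : ℂ) ^ d) (fun y => ?_) n y
  · rw [torusProb]
    simpa only [stepSymbol_ofReal] using h
  · have e : ∀ k : Fin d → ℕ, latticeExp (fun i => (dualFrequency L k i : ℂ)) y
        = ∏ i, Complex.exp (Complex.I * (((2 * Real.pi * k i / L : ℝ) : ℂ) * y i)) := by
      intro k
      rw [latticeExp, ← Complex.exp_sum, Finset.mul_sum]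
      rfl
    simp_rw [e]
    rw [← Finset.prod_univ_sum (fun _ : Fin d => Finset.range L)
      (fun i j => Complex.exp (Complex.I * (((2 * Real.pi * j / L : ℝ) : ℂ) * y i)))]
    simp_rw [sum_exp_dualFrequency hL]
    by_cases hy : y ∈ multiples d L
    · rw [Set.indicator_of_mem hy, Finset.prod_congr rfl fun i _ => if_pos (hy i)]
      simp
    · rw [Set.indicator_of_notMem hy]
      simp only [multiples, Set.mem_ofPred_eq, not_forall] at hy
      obtain ⟨i, hi⟩ := hy
      rw [Finset.prod_eq_zero (Finset.mem_univ i) (if_neg hi)]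
      simp

/-- Injectivity of `m` leaves at most one index with `m j = 0`. The unrestricted sum factorises into
`d` geometric sums, from which the all-zero term, if there is one, is removed. -/
lemma sum_piFinset_pow_natAbs_le {d : ℕ} (hd : 0 < d) {r : ℝ} (hr0 : 0 ≤ r) (hr1 : r < 1)
    {T : Finset ℕ} {m : ℕ → ℤ} (hm : Set.InjOn m T) :
    ∑ k ∈ Fintype.piFinset fun _ : Fin d => T,
      (if ∀ i, m (k i) = 0 then 0 else ∏ i, r ^ (m (k i)).natAbs)
      ≤ (1 + 2 * r / (1 - r)) ^ d - 1 := by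
  classical
  set a := 2 * r / (1 - r) with ha
  have ha0 : 0 ≤ a := div_nonneg (by linarith) (by linarith)
  set S := T.filter fun j => m j = 0 with hS
  set U := T.filter fun j => ¬ m j = 0 with hU
  have hcard : S.card ≤ 1 := by
    rw [Finset.card_le_one]
    intro x hx y hy
    rw [hS, Finset.mem_filter] at hx hy
    exact hm hx.1 hy.1 (hx.2.trans hy.2.symm)
  have hsplit : ∑ j ∈ T, r ^ (m j).natAbs = S.card + ∑ j ∈ U, r ^ (m j).natAbs := by
    rw [← Finset.sum_filter_add_sum_filter_not T (fun j => m j = 0)]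
    congr 1
    rw [Finset.sum_congr rfl (g := fun _ => (1 : ℝ))]
    · simp [hS]
    · intro j hj
      simp [(Finset.mem_filter.1 hj).2]
  have hUa : ∑ j ∈ U, r ^ (m j).natAbs ≤ a := by
    have hmU : Set.InjOn m (U : Set ℕ) := hm.mono (by
      rw [hU]; exact_mod_cast Finset.filter_subset _ _)
    rw [← Finset.sum_image (f := fun z : ℤ => r ^ z.natAbs) hmU]
    refine sum_pow_natAbs_le hr0 hr1 ?_
    simp [hU]
  have hU0 : 0 ≤ ∑ j ∈ U, r ^ (m j).natAbs := Finset.sum_nonneg fun j _ => pow_nonneg hr0 _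
  have htot : ∑ k ∈ Fintype.piFinset fun _ : Fin d => T, ∏ i, r ^ (m (k i)).natAbs
      = (S.card + ∑ j ∈ U, r ^ (m j).natAbs) ^ d := by
    rw [← hsplit, ← Finset.prod_univ_sum (fun _ : Fin d => T) (fun _ j => r ^ (m j).natAbs)]
    simp
  have hzero : ∑ k ∈ Fintype.piFinset fun _ : Fin d => T,
      (if ∀ i, m (k i) = 0 then ∏ i, r ^ (m (k i)).natAbs else 0) = (S.card : ℝ) ^ d := by
    rw [← Finset.sum_filter, Finset.sum_congr rfl (g := fun _ => (1 : ℝ))]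
    · have : (Fintype.piFinset fun _ : Fin d => T).filter (fun k => ∀ i, m (k i) = 0)
          = Fintype.piFinset fun _ : Fin d => S := by
        ext k
        simp only [hS, Finset.mem_filter, Fintype.mem_piFinset, ← forall_and]
      rw [this]
      simp
    · intro k hk
      refine Finset.prod_eq_one fun i _ => ?_
      simp [(Finset.mem_filter.1 hk).2 i]
  have hdiff : ∑ k ∈ Fintype.piFinset fun _ : Fin d => T,
      (if ∀ i, m (k i) = 0 then 0 else ∏ i, r ^ (m (k i)).natAbs)
      = (S.card + ∑ j ∈ U, r ^ (m j).natAbs) ^ d - (S.card : ℝ) ^ d := by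
    rw [← htot, ← hzero, ← Finset.sum_sub_distrib]
    refine Finset.sum_congr rfl fun k _ => ?_
    split_ifs <;> ring
  rw [hdiff]
  obtain h | h : S.card = 0 ∨ S.card = 1 := by omega
  · rw [h, Nat.cast_zero, zero_add, zero_pow hd.ne', sub_zero]
    refine (pow_le_pow_left₀ hU0 hUa d).trans ?_
    obtain ⟨e, rfl⟩ := Nat.exists_eq_succ_of_ne_zero hd.ne'
    have h1 : 1 ≤ (1 + a) ^ e := one_le_pow₀ (by linarith)
    have h2 : a ^ e ≤ (1 + a) ^ e := pow_le_pow_left₀ ha0 (by linarith) e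
    rw [Nat.succ_eq_add_one, pow_succ, pow_succ]
    nlinarith
  · rw [h, Nat.cast_one, one_pow]
    gcongr

/-- Use `1 - cos (π m / L) ≥ 2 m² / L²`, then `n ≥ K L²` and `m² ≥ |m|`. Angles are integer
multiples of `π / L`, not of `2π / L`, so that distances to both `0` and `π` are covered for every
parity of `L`. -/
lemma exp_cos_le_pow_natAbs {d L n : ℕ} (hL : 0 < L) {K : ℝ} (hK : 0 ≤ K)
    (hn : K * (L : ℝ) ^ 2 ≤ n) {m : ℤ} (hm : |m| ≤ L) {c : ℝ}
    (hc : c = Real.cos (Real.pi * m / L)) :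
    Real.exp (-(n / d) * (1 - c)) ≤ Real.exp (-(2 * K / d)) ^ m.natAbs := by
  have hL' : (0 : ℝ) < L := by exact_mod_cast hL
  have hpi := Real.pi_pos
  have hm' : |(m : ℝ)| ≤ L := by exact_mod_cast hm
  have h1 := Real.cos_le_one_sub_mul_cos_sq (x := Real.pi * m / L) (by
    rw [abs_div, abs_mul, abs_of_pos hpi, abs_of_pos hL', div_le_iff₀ hL']
    gcongr)
  have h2 : 2 / Real.pi ^ 2 * (Real.pi * m / L) ^ 2 = 2 * (m : ℝ) ^ 2 / (L : ℝ) ^ 2 := by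
    field_simp
  rw [h2, ← hc] at h1
  have h3 : ((m.natAbs : ℕ) : ℝ) ≤ (m : ℝ) ^ 2 := by
    rw [Nat.cast_natAbs, Int.cast_abs]
    rw [← sq_abs]
    exact_mod_cast Int.le_self_sq |m|
  rw [← Real.exp_nat_mul, Real.exp_le_exp]
  have h4 : K * (2 * (m : ℝ) ^ 2) ≤ n * (1 - c) := by
    calc K * (2 * (m : ℝ) ^ 2) = K * (L : ℝ) ^ 2 * (2 * (m : ℝ) ^ 2 / (L : ℝ) ^ 2) := by field_simp
      _ ≤ n * (1 - c) := by
        gcongr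
        linarith
  have h5 : (m.natAbs : ℝ) * (2 * K / d) ≤ n / d * (1 - c) := by
    calc (m.natAbs : ℝ) * (2 * K / d) ≤ (m : ℝ) ^ 2 * (2 * K / d) := by gcongr
      _ = K * (2 * (m : ℝ) ^ 2) / d := by ring
      _ ≤ n * (1 - c) / d := by gcongr
      _ = _ := by ring
  linarith

/-- The zero frequency contributes exactly `2`. Any other frequency is bounded by its distance to
the origin when the symbol is positive, and by its distance to `(π, …, π)` when it is negative; both
families sum geometrically. -/
lemma abs_torusProb_add_sub_le {d : ℕ} (hd : 0 < d) {L n : ℕ} (hL : 0 < L) {K : ℝ} (hK : 0 < K)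
    (hn : K * (L : ℝ) ^ 2 ≤ n) (x : Fin d → ℤ) :
    |torusProb d L n x + torusProb d L (n + 1) x - 2 / (L : ℝ) ^ d|
      ≤ 4 * ((1 + 2 * Real.exp (-(2 * K / d)) / (1 - Real.exp (-(2 * K / d)))) ^ d - 1)
        / (L : ℝ) ^ d := by
  classical
  have hd' : (0 : ℝ) < d := by exact_mod_cast hd
  have hL' : (0 : ℝ) < L := by exact_mod_cast hL
  have hn0 : n ≠ 0 := by
    rintro rfl
    have : 0 < K * (L : ℝ) ^ 2 := by positivity
    rw [Nat.cast_zero] at hn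
    linarith
  set r := Real.exp (-(2 * K / d)) with hr
  have hr0 : 0 ≤ r := (Real.exp_pos _).le
  have hr1 : r < 1 := Real.exp_lt_one_iff.2 (by rw [neg_lt_zero]; positivity)
  set T := Finset.range L with hT
  set I := Fintype.piFinset fun _ : Fin d => T with hI
  set s : (Fin d → ℕ) → ℝ := fun k => realSymbol (dualFrequency L k) with hs
  set h : (Fin d → ℕ) → ℝ := fun k => s k ^ n * (1 + s k) with hh
  set X : (Fin d → ℕ) → ℂ := fun k => latticeExp (fun i => (dualFrequency L k i : ℂ)) x with hX
  -- In units of `π / L`, `m₁` is the offset of the frequency `2π j / L` from `0` modulo `2π`, and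
  -- `m₂` its offset from `π`.
  set m₁ : ℕ → ℤ := fun j => if 2 * j ≤ L then 2 * j else 2 * j - 2 * L with hm₁
  set m₂ : ℕ → ℤ := fun j => 2 * j - L with hm₂
  have hinj₁ : Set.InjOn m₁ T := by
    intro a ha b hb hab
    simp only [hT, Finset.coe_range, Set.mem_Iio] at ha hb
    simp only [hm₁] at hab
    split_ifs at hab <;> omega
  have hinj₂ : Set.InjOn m₂ T := by
    intro a ha b hb hab
    simp only [hm₂] at hab
    omega
  set F₁ : (Fin d → ℕ) → ℝ := fun k =>
    if ∀ i, m₁ (k i) = 0 then 0 else ∏ i, r ^ (m₁ (k i)).natAbs with hF₁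
  set F₂ : (Fin d → ℕ) → ℝ := fun k =>
    if ∀ i, m₂ (k i) = 0 then 0 else ∏ i, r ^ (m₂ (k i)).natAbs with hF₂
  have hF₂0 : ∀ k, 0 ≤ F₂ k := fun k => by
    simp only [hF₂]; split_ifs <;> positivity
  have hmemT : ∀ {k}, k ∈ I → ∀ i, k i < L := fun {k} hk i => by
    have := Fintype.mem_piFinset.1 hk i
    simpa [hT] using this
  have hpos : ∀ k ∈ I, k ≠ 0 → max (s k) 0 ^ n ≤ F₁ k := by
    intro k hk hk0
    have hne : ¬ ∀ i, m₁ (k i) = 0 := by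
      intro hall
      apply hk0
      ext i
      have h1 := hall i
      have h2 := hmemT hk i
      simp only [hm₁] at h1
      simp only [Pi.zero_apply]
      split_ifs at h1 <;> omega
    simp only [hF₁, if_neg hne]
    refine (max_realSymbol_pow_le hd _ n).trans (Finset.prod_le_prod
      (fun i _ => (Real.exp_pos _).le) fun i _ => exp_cos_le_pow_natAbs hL hK.le hn ?_ ?_)
    · have h2 := hmemT hk i
      simp only [hm₁, abs_le]
      split_ifs <;> omega
    · simp only [hm₁, dualFrequency]
      split_ifs
      · congr 1; push_cast; ring
      · rw [← Real.cos_sub_two_pi]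
        congr 1
        push_cast
        field_simp
  have hneg : ∀ k ∈ I, max (-s k) 0 ^ n * (1 + s k) ≤ 2 * F₂ k := by
    intro k hk
    have hs1 := abs_le.1 (abs_realSymbol_le_one (dualFrequency L k))
    by_cases hall : ∀ i, m₂ (k i) = 0
    -- All coordinates equal `π`, which occurs only for even `L`: there is no decay in `n`, but the
    -- factor `1 + s k` is zero.
    · have hsk : s k = -1 := by
        have h1 := one_add_realSymbol hd (dualFrequency L k)
        have h2 : ∀ i, 1 + Real.cos (dualFrequency L k i) = 0 := by
          intro i
          have h3 := hall i
          simp only [hm₂] at h3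
          have h4 : (2 : ℝ) * k i = L := by
            have : (2 : ℤ) * k i = L := by linarith
            exact_mod_cast this
          have h5 : dualFrequency L k i = Real.pi := by
            rw [dualFrequency, div_eq_iff hL'.ne', ← h4]; ring
          rw [h5, Real.cos_pi]; ring
        rw [Finset.sum_eq_zero fun i _ => h2 i, zero_div] at h1
        simp only [hs]
        linarith
      rw [hsk]
      simpa using hF₂0 k
    · have h1 : max (-s k) 0 ^ n ≤ F₂ k := by
        simp only [hF₂, if_neg hall]
        refine (max_neg_realSymbol_pow_le hd _ n).trans (Finset.prod_le_prod
          (fun i _ => (Real.exp_pos _).le) fun i _ => ?_)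
        have h2 := hmemT hk i
        have h3 := exp_cos_le_pow_natAbs (d := d) hL hK.le hn (m := m₂ (k i))
          (c := -Real.cos (dualFrequency L k i)) (by simp only [hm₂, abs_le]; omega) (by
            rw [← Real.cos_sub_pi]
            congr 1
            simp only [hm₂, dualFrequency]
            push_cast
            field_simp)
        simpa using h3
      calc max (-s k) 0 ^ n * (1 + s k) ≤ F₂ k * 2 :=
            mul_le_mul h1 (by simp only [hs]; linarith) (by simp only [hs]; linarith) (hF₂0 k)
        _ = _ := mul_comm _ _
  have hterm : ∀ k ∈ I.erase 0, ‖(h k : ℂ) * X k‖ ≤ 2 * F₁ k + 2 * F₂ k := by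
    intro k hk
    have hk' := Finset.mem_erase.1 hk
    have hs1 := abs_le.1 (abs_realSymbol_le_one (dualFrequency L k))
    have h1 := hpos k hk'.2 hk'.1
    have h2 := hneg k hk'.2
    have hs2 : 0 ≤ 1 + s k := by simp only [hs]; linarith
    have hs3 : 1 + s k ≤ 2 := by simp only [hs]; linarith
    have hnorm : ‖(h k : ℂ) * X k‖ = |s k| ^ n * (1 + s k) := by
      rw [norm_mul, norm_latticeExp_ofReal, mul_one, Complex.norm_real, Real.norm_eq_abs, hh,
        abs_mul, abs_pow, abs_of_nonneg hs2]
    rw [hnorm]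
    have hF1 : 0 ≤ F₁ k := (pow_nonneg (le_max_right _ _) n).trans h1
    rcases le_total 0 (s k) with hsk | hsk
    · rw [abs_of_nonneg hsk]
      rw [max_eq_left hsk] at h1
      have : s k ^ n * (1 + s k) ≤ F₁ k * 2 := mul_le_mul h1 hs3 hs2 hF1
      linarith [hF₂0 k]
    · rw [abs_of_nonpos hsk]
      rw [max_eq_left (by linarith)] at h2
      linarith
  have hF₁0 : ∀ k, 0 ≤ F₁ k := fun k => by
    simp only [hF₁]; split_ifs <;> positivity
  have h0mem : (0 : Fin d → ℕ) ∈ I := by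
    rw [hI, Fintype.mem_piFinset]
    intro i
    simpa [hT] using hL
  have hsum : ((L : ℂ) ^ d) * ((torusProb d L n x + torusProb d L (n + 1) x : ℝ) : ℂ)
      = ∑ k ∈ I, (h k : ℂ) * X k := by
    rw [Complex.ofReal_add, mul_add, torusProb_eq_sum hL, torusProb_eq_sum hL,
      ← Finset.sum_add_distrib]
    refine Finset.sum_congr rfl fun k _ => ?_
    simp only [hh, hs, hX]
    push_cast
    ring
  have hzero : (h 0 : ℂ) * X 0 = 2 := by
    have h1 : dualFrequency L (0 : Fin d → ℕ) = 0 := by ext i; simp [dualFrequency]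
    have h2 : s 0 = 1 := by
      simp only [hs, h1]
      simp [realSymbol, hd'.ne']
    simp only [hh, h2, hX, h1]
    simp [latticeExp]
    norm_num
  have hkey : ‖(((L : ℝ) ^ d * (torusProb d L n x + torusProb d L (n + 1) x) - 2 : ℝ) : ℂ)‖
      ≤ 4 * ((1 + 2 * r / (1 - r)) ^ d - 1) := by
    have e : (((L : ℝ) ^ d * (torusProb d L n x + torusProb d L (n + 1) x) - 2 : ℝ) : ℂ)
        = ∑ k ∈ I.erase 0, (h k : ℂ) * X k := by
      have h1 := Finset.add_sum_erase I (fun k => (h k : ℂ) * X k) h0mem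
      rw [← hsum, hzero] at h1
      rw [Complex.ofReal_sub, Complex.ofReal_mul]
      push_cast at h1 ⊢
      linear_combination -h1
    rw [e]
    calc ‖∑ k ∈ I.erase 0, (h k : ℂ) * X k‖ ≤ ∑ k ∈ I.erase 0, (2 * F₁ k + 2 * F₂ k) :=
          norm_sum_le_of_le _ hterm
      _ ≤ ∑ k ∈ I, (2 * F₁ k + 2 * F₂ k) :=
          Finset.sum_le_sum_of_subset_of_nonneg (Finset.erase_subset _ _) fun k _ _ => by
            linarith [hF₁0 k, hF₂0 k]
      _ = 2 * ∑ k ∈ I, F₁ k + 2 * ∑ k ∈ I, F₂ k := by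
          rw [Finset.sum_add_distrib, Finset.mul_sum, Finset.mul_sum]
      _ ≤ _ := by
          have e1 := sum_piFinset_pow_natAbs_le hd hr0 hr1 hinj₁
          have e2 := sum_piFinset_pow_natAbs_le hd hr0 hr1 hinj₂
          linarith
  rw [Complex.norm_real, Real.norm_eq_abs] at hkey
  have hLd : (0 : ℝ) < (L : ℝ) ^ d := by positivity
  have e : torusProb d L n x + torusProb d L (n + 1) x - 2 / (L : ℝ) ^ d
      = ((L : ℝ) ^ d * (torusProb d L n x + torusProb d L (n + 1) x) - 2) / (L : ℝ) ^ d := by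
    field_simp
  rw [e, abs_div, abs_of_pos hLd]
  gcongr

lemma exists_abs_torusProb_add_sub_le {d : ℕ} (hd : 0 < d) {δ : ℝ} (hδ : 0 < δ) :
    ∃ K₀ > (0 : ℝ), ∀ K ≥ K₀, ∀ {L n : ℕ}, 0 < L → K * (L : ℝ) ^ 2 ≤ n → ∀ x : Fin d → ℤ,
      |torusProb d L n x + torusProb d L (n + 1) x - 2 / (L : ℝ) ^ d| ≤ δ / (L : ℝ) ^ d := by
  have hd' : (0 : ℝ) < d := by exact_mod_cast hd
  have hr : Tendsto (fun K : ℝ => Real.exp (-(2 * K / d))) atTop (nhds 0) := by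
    refine Real.tendsto_exp_neg_atTop_nhds_zero.comp ?_
    refine Tendsto.atTop_div_const hd' ?_
    exact tendsto_id.const_mul_atTop two_pos
  have hlim : Tendsto (fun K : ℝ => 4 * ((1 + 2 * Real.exp (-(2 * K / d))
      / (1 - Real.exp (-(2 * K / d)))) ^ d - 1)) atTop (nhds 0) := by
    have h1 := ((((hr.const_mul 2).div (hr.const_sub 1) (by norm_num)).const_add 1).pow d
      |>.sub_const 1).const_mul 4
    simpa using h1
  obtain ⟨K₁, hK₁⟩ := eventually_atTop.1 (hlim.eventually_le_const hδ)
  refine ⟨max K₁ 1, by positivity, fun K hK L n hL hn x => ?_⟩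
  have hK0 : 0 < K := lt_of_lt_of_le one_pos ((le_max_right _ _).trans hK)
  refine (abs_torusProb_add_sub_le hd hL hK0 hn x).trans ?_
  have := hK₁ K ((le_max_left _ _).trans hK)
  gcongr

/-! ### Bounds on the excess at one time and at two consecutive times -/

lemma zero_mem_torusBox {d L : ℕ} (hL : 0 < L) : (0 : Fin d → ℤ) ∈ torusBox d L := by
  intro i
  simp only [Pi.zero_apply]
  split_ifs <;> omega

lemma torusProb_zero_eq {d L : ℕ} (hL : 0 < L) {x : Fin d → ℤ} (hx : x ∈ torusBox d L) :
    torusProb d L 0 x = latticeProb d 0 x := by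
  simp only [torusProb, latticeProb, Function.iterate_zero, id]
  by_cases h : x = 0
  · subst h
    rw [Set.indicator_of_mem (Set.mem_singleton _), Set.indicator_of_mem]
    intro i
    simp
  · have hm : x ∉ multiples d L := fun hm =>
      h (torusBox_unique hL hx (zero_mem_torusBox hL) (by simpa using hm))
    have h0 : x ∉ ({0} : Set (Fin d → ℤ)) := h
    rw [Set.indicator_of_notMem hm, Set.indicator_of_notMem h0]

lemma exists_torusProb_sub_latticeProb_le {d : ℕ} (hd : 0 < d) :
    ∃ C : ℝ, 0 ≤ C ∧ ∀ {L : ℕ}, 0 < L → ∀ {x : Fin d → ℤ}, x ∈ torusBox d L → ∀ n,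
      torusProb d L n x - latticeProb d n x ≤ C / (L : ℝ) ^ d := by
  obtain ⟨C₁, hC₁, h₁⟩ := torusProb_sub_latticeProb_le_of_le_sq hd
  set C₂ := 4 * ((1 + 2 * Real.exp (-(2 * 1 / d)) / (1 - Real.exp (-(2 * 1 / d)))) ^ d - 1) with hC₂
  refine ⟨max C₁ (2 + C₂), hC₁.trans (le_max_left _ _), fun {L} hL {x} hx n => ?_⟩
  have hL' : (0 : ℝ) < (L : ℝ) ^ d := pow_pos (by exact_mod_cast hL) d
  rcases Nat.eq_zero_or_pos n with rfl | hn
  · rw [torusProb_zero_eq hL hx, sub_self]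
    exact div_nonneg (hC₁.trans (le_max_left _ _)) hL'.le
  · rcases le_total n (L ^ 2) with hle | hle
    · refine (h₁ hL hle hn hx).trans ?_
      gcongr
      exact le_max_left _ _
    -- The kernels at time `n + 1` and the lattice kernel enter with a favourable sign, so the
    -- two-time bound controls time `n` alone.
    · have h2 := abs_torusProb_add_sub_le hd hL one_pos (n := n)
        (by rw [one_mul]; exact_mod_cast hle) x
      rw [← hC₂] at h2
      have h3 := (abs_le.1 h2).2
      have h4 := torusProb_nonneg (L := L) (n + 1) x
      have h5 := latticeProb_nonneg n x
      calc torusProb d L n x - latticeProb d n x ≤ 2 / (L : ℝ) ^ d + C₂ / (L : ℝ) ^ d := by linarith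
        _ = (2 + C₂) / (L : ℝ) ^ d := by ring
        _ ≤ _ := by gcongr; exact le_max_right _ _

lemma latticeProb_le_inv_sqrt_pow {d n : ℕ} (hd : 0 < d) (hn : 0 < n) (y : Fin d → ℤ) :
    latticeProb d n y ≤ kernelConst d * Real.exp 1 / Real.sqrt n ^ d := by
  refine (latticeProb_le hd hn ⟨0, hd⟩ y).trans (mul_le_of_le_one_right ?_ ?_)
  · have := kernelConst_nonneg d
    positivity
  · rw [Real.exp_le_one_iff, neg_div, neg_nonpos]
    positivity

lemma exists_abs_excess_add_sub_le {d : ℕ} (hd : 0 < d) {δ : ℝ} (hδ : 0 < δ) :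
    ∃ K > (0 : ℝ), ∀ {L n : ℕ}, 0 < L → K * (L : ℝ) ^ 2 ≤ n → ∀ x : Fin d → ℤ,
      |(torusProb d L n x - latticeProb d n x) + (torusProb d L (n + 1) x
        - latticeProb d (n + 1) x) - 2 / (L : ℝ) ^ d| ≤ δ / (L : ℝ) ^ d := by
  obtain ⟨K₀, hK₀, h⟩ := exists_abs_torusProb_add_sub_le hd (half_pos hδ)
  set C := kernelConst d * Real.exp 1 with hC
  have hC0 : 0 ≤ C := mul_nonneg (kernelConst_nonneg d) (Real.exp_pos _).le
  -- Half of `δ` goes to the torus kernels and a quarter to each lattice kernel: `√K ≥ 4 C / δ`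
  -- makes `C n^(-d/2)` at most `(δ / 4) / L^d` for `n ≥ K L²`.
  set K := max K₀ (max 1 ((4 * C / δ) ^ 2)) with hK
  have hK1 : 1 ≤ K := (le_max_left _ _).trans (le_max_right _ _)
  have hK2 : (4 * C / δ) ^ 2 ≤ K := (le_max_right _ _).trans (le_max_right _ _)
  refine ⟨K, by linarith, fun {L n} hL hn x => ?_⟩
  have hL' : (0 : ℝ) < L := by exact_mod_cast hL
  have h1 := h K (le_max_left _ _) hL hn x
  have hn' : (0 : ℝ) < n := lt_of_lt_of_le (by positivity) hn
  have hn0 : 0 < n := by exact_mod_cast hn'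
  have hsK : 1 ≤ Real.sqrt K := Real.one_le_sqrt.2 hK1
  have hsqrt : Real.sqrt K * L ≤ Real.sqrt n := by
    rw [← Real.sqrt_sq hL'.le, ← Real.sqrt_mul (by linarith)]
    exact Real.sqrt_le_sqrt hn
  have hpow : Real.sqrt K * (L : ℝ) ^ d ≤ Real.sqrt n ^ d := by
    refine le_trans ?_ (pow_le_pow_left₀ (by positivity) hsqrt d)
    rw [mul_pow]
    gcongr
    exact le_self_pow₀ hsK hd.ne'
  have hCK : 4 * C ≤ δ * Real.sqrt K := by
    have := Real.le_sqrt_of_sq_le hK2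
    rw [div_le_iff₀ hδ] at this
    linarith
  have hp : ∀ m ≥ n, latticeProb d m x ≤ δ / 4 / (L : ℝ) ^ d := by
    intro m hm
    refine (latticeProb_le_inv_sqrt_pow hd (lt_of_lt_of_le hn0 hm) x).trans ?_
    have hmn : Real.sqrt n ^ d ≤ Real.sqrt m ^ d := by
      gcongr
    rw [div_le_div_iff₀ (lt_of_lt_of_le (by positivity) hmn) (by positivity)]
    calc C * (L : ℝ) ^ d ≤ (δ / 4 * Real.sqrt K) * (L : ℝ) ^ d := by gcongr; linarith
      _ = δ / 4 * (Real.sqrt K * (L : ℝ) ^ d) := by ring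
      _ ≤ δ / 4 * Real.sqrt m ^ d := by gcongr; exact hpow.trans hmn
  have h2 := hp n le_rfl
  have h3 := hp (n + 1) (Nat.le_succ n)
  have h4 := latticeProb_nonneg n x
  have h5 := latticeProb_nonneg (n + 1) x
  have e : δ / (L : ℝ) ^ d = δ / 2 / (L : ℝ) ^ d + 2 * (δ / 4 / (L : ℝ) ^ d) := by ring
  rw [abs_le] at h1 ⊢
  constructor <;> linarith [h1.1, h1.2]

/-- Beyond `K L²` the excess is near `2 / L^d`. Before that, the one image `x + L e₀` lies within
distance of order `√n`, and the local limit theorem gives it mass of order `n^(-d/2)`, at least a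
constant over `L^d`. -/
lemma exists_le_excess_add {d : ℕ} (hd : 0 < d) {ε : ℝ} (hε : 0 < ε) :
    ∃ c > (0 : ℝ), ∃ L₀ : ℕ, ∀ {L n : ℕ}, 0 < L → L₀ ≤ L → ε * (L : ℝ) ^ 2 ≤ n →
      ∀ {x : Fin d → ℤ}, x ∈ torusBox d L →
      c / (L : ℝ) ^ d ≤ (torusProb d L n x - latticeProb d n x) + (torusProb d L (n + 1) x
        - latticeProb d (n + 1) x) := by
  have hd' : (0 : ℝ) < d := by exact_mod_cast hd
  obtain ⟨K, hK, hbig⟩ := exists_abs_excess_add_sub_le hd one_pos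
  -- Each coordinate of the image is at most `2 L`, so its squared norm is at most `4 d L² ≤ (4 d /
  -- ε) n`.
  obtain ⟨c, hc, n₀, hsmall⟩ := exists_const_le_latticeProb_add hd (4 * d / ε)
  refine ⟨min 1 (c / Real.sqrt K ^ d), by positivity, ⌈n₀ / ε⌉₊, ?_⟩
  intro L n hL hL₀ hn x hx
  have hL' : (0 : ℝ) < L := by exact_mod_cast hL
  have hL1 : (1 : ℝ) ≤ L := by exact_mod_cast hL
  have hn' : (0 : ℝ) < n := lt_of_lt_of_le (by positivity) hn
  rcases le_total (K * (L : ℝ) ^ 2) n with h | h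
  · have h1 := (abs_le.1 (hbig hL h x)).1
    have h2 : min 1 (c / Real.sqrt K ^ d) / (L : ℝ) ^ d ≤ 1 / (L : ℝ) ^ d := by
      gcongr; exact min_le_left _ _
    have e : 2 / (L : ℝ) ^ d = 1 / (L : ℝ) ^ d + 1 / (L : ℝ) ^ d := by ring
    linarith
  · set e₀ : Fin d → ℤ := Pi.single ⟨0, hd⟩ 1 with he₀
    have he0 : e₀ ≠ 0 := by simp [he₀]
    have hn₀ : n₀ ≤ n := by
      have h1 : (n₀ : ℝ) / ε ≤ L := (Nat.le_ceil _).trans (by exact_mod_cast hL₀)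
      rw [div_le_iff₀ hε] at h1
      have h2 : (L : ℝ) * ε ≤ ε * (L : ℝ) ^ 2 := by nlinarith
      exact_mod_cast (h1.trans h2).trans hn
    have hy : ∑ i, ((x + (L : ℤ) • e₀) i : ℝ) ^ 2 ≤ 4 * d / ε * n := by
      have h1 : ∀ i, ((x + (L : ℤ) • e₀) i : ℝ) ^ 2 ≤ 4 * (L : ℝ) ^ 2 := by
        intro i
        have h2 : 2 * |(x i : ℝ)| ≤ L := by exact_mod_cast abs_two_mul_le_of_mem_torusBox hx i
        have h3 : |((L : ℝ) * (e₀ i : ℝ))| ≤ L := by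
          rw [abs_mul, abs_of_pos hL', he₀, Pi.single_apply]
          split_ifs <;> simp
        have h4 : |((x + (L : ℤ) • e₀) i : ℝ)| ≤ 2 * L := by
          simp only [Pi.add_apply, Pi.smul_apply, smul_eq_mul, Int.cast_add, Int.cast_mul,
            Int.cast_natCast]
          refine (abs_add_le _ _).trans ?_
          linarith
        rw [← sq_abs]
        calc |((x + (L : ℤ) • e₀) i : ℝ)| ^ 2 ≤ (2 * L) ^ 2 := by gcongr
          _ = _ := by ring
      calc ∑ i, ((x + (L : ℤ) • e₀) i : ℝ) ^ 2 ≤ ∑ _i : Fin d, 4 * (L : ℝ) ^ 2 :=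
            Finset.sum_le_sum fun i _ => h1 i
        _ = 4 * d / ε * (ε * (L : ℝ) ^ 2) := by
            rw [Finset.sum_const, Finset.card_univ, Fintype.card_fin, nsmul_eq_mul]
            field_simp
        _ ≤ _ := by gcongr
    have h1 := hsmall hn₀ hy
    have h2 := latticeProb_add_le_torusProb hL he0 n x
    have h3 := latticeProb_add_le_torusProb hL he0 (n + 1) x
    have hs : Real.sqrt n ≤ Real.sqrt K * L := by
      rw [← Real.sqrt_sq hL'.le, ← Real.sqrt_mul hK.le]
      exact Real.sqrt_le_sqrt h
    have h4 : min 1 (c / Real.sqrt K ^ d) / (L : ℝ) ^ d ≤ c / Real.sqrt n ^ d := by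
      calc min 1 (c / Real.sqrt K ^ d) / (L : ℝ) ^ d ≤ c / Real.sqrt K ^ d / (L : ℝ) ^ d := by
            gcongr; exact min_le_right _ _
        _ = c / (Real.sqrt K * L) ^ d := by rw [mul_pow, div_div]
        _ ≤ _ := by gcongr
    linarith

/-! ### Summation over time -/

lemma le_two_mul_sum_range {q : ℕ → ℝ} (hq : ∀ n, 0 ≤ q n) {a : ℕ} {b : ℝ} (hb : 0 ≤ b)
    (h : ∀ n ≥ a, b ≤ q n + q (n + 1)) (m : ℕ) :
    b * (m - a) ≤ 2 * ∑ n ∈ Finset.range (m + 1), q n := by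
  -- Twice the sum counts every interior term in two consecutive pairs; the last term belongs to one
  -- only, and the spare copy is carried in the induction.
  suffices hs : q m + b * (m - a) ≤ 2 * ∑ n ∈ Finset.range (m + 1), q n by linarith [hq m]
  have hge : ∀ m, q m ≤ ∑ n ∈ Finset.range (m + 1), q n := fun m =>
    Finset.single_le_sum (fun n _ => hq n) (Finset.self_mem_range_succ m)
  have hneg : ∀ m ≤ a, b * ((m : ℝ) - a) ≤ 0 := fun m hm =>
    mul_nonpos_of_nonneg_of_nonpos hb (sub_nonpos.2 (by exact_mod_cast hm))
  induction m with
  | zero => linarith [hge 0, hneg 0 (Nat.zero_le a), hq 0]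
  | succ m ih =>
    rcases le_or_gt a m with ham | ham
    · rw [Finset.sum_range_succ, mul_add]
      push_cast
      have := h m ham
      have e : b * ((m : ℝ) + 1 - a) = b * (m - a) + b := by ring
      linarith
    · linarith [hge (m + 1), hneg (m + 1) ham, hq (m + 1)]

lemma two_mul_sum_range_le {q : ℕ → ℝ} (hq : ∀ n, 0 ≤ q n) {a : ℕ} {b c : ℝ} (hb : 0 ≤ b)
    (hc : ∀ n, q n ≤ c) (h : ∀ n ≥ a, q n + q (n + 1) ≤ b) (m : ℕ) :
    2 * ∑ n ∈ Finset.range (m + 1), q n ≤ b * m + c * (2 * a + 3) := by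
  have hc0 : 0 ≤ c := (hq 0).trans (hc 0)
  suffices hs : 2 * ∑ n ∈ Finset.range (m + 1), q n ≤ q m + b * m + c * (2 * a + 2) by
    linarith [hc m]
  induction m with
  | zero =>
    have : 0 ≤ c * a := by positivity
    have h0 := hc 0
    simp only [zero_add, Finset.range_one, Finset.sum_singleton, Nat.cast_zero]
    linarith
  | succ m ih =>
    rcases le_or_gt a m with ham | ham
    · rw [Finset.sum_range_succ, mul_add]
      push_cast
      linarith [h m ham]
    · have h1 : ∑ n ∈ Finset.range (m + 1 + 1), q n ≤ (m + 2) * c := by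
        refine (Finset.sum_le_sum fun n _ => hc n).trans (le_of_eq ?_)
        rw [Finset.sum_const, Finset.card_range, nsmul_eq_mul]
        push_cast
        ring
      have h2 : (m : ℝ) + 1 ≤ a := by exact_mod_cast ham
      have h3 : ((m : ℝ) + 2) * c ≤ (a + 1) * c :=
        mul_le_mul_of_nonneg_right (by linarith) hc0
      have h4 : 0 ≤ b * ((m + 1 : ℕ) : ℝ) := by positivity
      linarith [hq (m + 1)]

lemma excessVisits_nonneg {d L : ℕ} (x : Fin d → ℤ) (m : ℕ) : 0 ≤ excessVisits d L x m :=
  Finset.sum_nonneg fun n _ => sub_nonneg.2 (latticeProb_le_torusProb n x)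

/-- The term at time `0` vanishes, so the bound is proportional to `m` rather than `m + 1`. This
matters in case (i), where the mean length may be small. -/
lemma exists_excessVisits_le {d : ℕ} (hd : 0 < d) :
    ∃ C : ℝ, 0 ≤ C ∧ ∀ {L : ℕ}, 0 < L → ∀ {x : Fin d → ℤ}, x ∈ torusBox d L → ∀ m : ℕ,
      excessVisits d L x m ≤ C / (L : ℝ) ^ d * m := by
  obtain ⟨C, hC, h⟩ := exists_torusProb_sub_latticeProb_le hd
  refine ⟨C, hC, fun {L} hL {x} hx m => ?_⟩
  rw [excessVisits, Finset.sum_range_succ', torusProb_zero_eq hL hx, sub_self, add_zero]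
  refine (Finset.sum_le_sum fun n _ => h hL hx (n + 1)).trans (le_of_eq ?_)
  rw [Finset.sum_const, Finset.card_range, nsmul_eq_mul, mul_comm]

lemma exists_le_excessVisits {d : ℕ} (hd : 0 < d) {ε : ℝ} (hε : 0 < ε) :
    ∃ c > (0 : ℝ), ∃ L₀ : ℕ, ∀ {L : ℕ}, 0 < L → L₀ ≤ L → ∀ {x : Fin d → ℤ},
      x ∈ torusBox d L → ∀ m : ℕ,
      c / (L : ℝ) ^ d * (m - (ε * (L : ℝ) ^ 2 + 1)) ≤ excessVisits d L x m := by
  obtain ⟨c, hc, L₀, h⟩ := exists_le_excess_add hd hε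
  refine ⟨c / 2, by positivity, L₀, fun {L} hL hL₀ {x} hx m => ?_⟩
  have h1 := le_two_mul_sum_range (q := fun n => torusProb d L n x - latticeProb d n x)
    (fun n => sub_nonneg.2 (latticeProb_le_torusProb n x)) (a := ⌈ε * (L : ℝ) ^ 2⌉₊)
    (b := c / (L : ℝ) ^ d) (by positivity)
    (fun n hn => h hL hL₀ (Nat.ceil_le.1 hn) hx) m
  have h2 := (Nat.ceil_lt_add_one (show 0 ≤ ε * (L : ℝ) ^ 2 by positivity)).le
  have h3 : c / (L : ℝ) ^ d * (m - (ε * (L : ℝ) ^ 2 + 1))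
      ≤ c / (L : ℝ) ^ d * (m - ⌈ε * (L : ℝ) ^ 2⌉₊) := by gcongr
  have e : c / 2 / (L : ℝ) ^ d * (m - (ε * (L : ℝ) ^ 2 + 1))
      = c / (L : ℝ) ^ d * (m - (ε * (L : ℝ) ^ 2 + 1)) / 2 := by ring
  rw [e, excessVisits]
  linarith

lemma exists_abs_excessVisits_sub_le {d : ℕ} (hd : 0 < d) {δ : ℝ} (hδ : 0 < δ) :
    ∃ B : ℝ, 0 < B ∧ ∀ {L : ℕ}, 0 < L → ∀ {x : Fin d → ℤ}, x ∈ torusBox d L → ∀ m : ℕ,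
      |excessVisits d L x m - m / (L : ℝ) ^ d|
        ≤ (δ * m + B * (L : ℝ) ^ 2) / (L : ℝ) ^ d := by
  -- Keeps the lower pair bound `2 - δ'` nonnegative.
  set δ' := min δ 1 with hδ'
  have hδ0 : 0 < δ' := by positivity
  have hδ1 : δ' ≤ 1 := min_le_right _ _
  obtain ⟨K, hK, h⟩ := exists_abs_excess_add_sub_le hd hδ0
  obtain ⟨C, hC, hup⟩ := exists_torusProb_sub_latticeProb_le hd
  -- The cutoff `a ≤ K L² + 1` gives `2 a + 3 ≤ (2 K + 5) L²`, which covers the unmixed initial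
  -- times in both bounds.
  refine ⟨(1 + C) * (2 * K + 5), by positivity, fun {L} hL {x} hx m => ?_⟩
  have hL1 : (1 : ℝ) ≤ L := by exact_mod_cast hL
  have hL2 : (1 : ℝ) ≤ (L : ℝ) ^ 2 := one_le_pow₀ hL1
  have hLd : (0 : ℝ) < (L : ℝ) ^ d := by positivity
  set a := ⌈K * (L : ℝ) ^ 2⌉₊ with ha
  have ha2 : (a : ℝ) ≤ K * (L : ℝ) ^ 2 + 1 :=
    (Nat.ceil_lt_add_one (show 0 ≤ K * (L : ℝ) ^ 2 by positivity)).le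
  set q : ℕ → ℝ := fun n => torusProb d L n x - latticeProb d n x with hq
  have hq0 : ∀ n, 0 ≤ q n := fun n => sub_nonneg.2 (latticeProb_le_torusProb n x)
  have hlow := le_two_mul_sum_range hq0 (a := a) (b := (2 - δ') / (L : ℝ) ^ d)
    (div_nonneg (by linarith) hLd.le) (fun n hn => by
      have h1 := (abs_le.1 (h hL (Nat.ceil_le.1 hn) x)).1
      rw [sub_div]
      simp only [hq]
      linarith) m
  have hupp := two_mul_sum_range_le hq0 (a := a) (b := (2 + δ') / (L : ℝ) ^ d)
    (c := C / (L : ℝ) ^ d) (by positivity) (fun n => hup hL hx n) (fun n hn => by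
      have h1 := (abs_le.1 (h hL (Nat.ceil_le.1 hn) x)).2
      rw [add_div]
      simp only [hq]
      linarith) m
  have hX : excessVisits d L x m = ∑ n ∈ Finset.range (m + 1), q n := rfl
  rw [hX]
  set s := ∑ n ∈ Finset.range (m + 1), q n
  have hm0 : (0 : ℝ) ≤ m := by positivity
  have hδm : δ' * m ≤ δ * m := by gcongr; exact min_le_left _ _
  have hlow' : (2 - δ') * (m - a) ≤ 2 * (s * (L : ℝ) ^ d) := by
    rw [div_mul_eq_mul_div, div_le_iff₀ hLd] at hlow
    linarith
  have hupp' : 2 * (s * (L : ℝ) ^ d) ≤ (2 + δ') * m + C * (2 * a + 3) := by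
    have e : (2 + δ') / (L : ℝ) ^ d * m + C / (L : ℝ) ^ d * (2 * a + 3)
        = ((2 + δ') * m + C * (2 * a + 3)) / (L : ℝ) ^ d := by ring
    rw [e, le_div_iff₀ hLd] at hupp
    linarith
  have e : s - m / (L : ℝ) ^ d = (s * (L : ℝ) ^ d - m) / (L : ℝ) ^ d := by field_simp
  rw [e, abs_div, abs_of_pos hLd]
  gcongr
  have ha0 : (0 : ℝ) ≤ a := by positivity
  have h1 : 2 * (a : ℝ) + 3 ≤ (2 * K + 5) * (L : ℝ) ^ 2 := by nlinarith
  have h2 : C * (2 * a + 3) ≤ C * ((2 * K + 5) * (L : ℝ) ^ 2) := by gcongr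
  have h3 : 0 ≤ C * ((2 * K + 5) * (L : ℝ) ^ 2) := by positivity
  have h4 : 0 ≤ δ' * a := by positivity
  have h5 : 0 ≤ δ' * m := by positivity
  have e2 : (1 + C) * (2 * K + 5) * (L : ℝ) ^ 2
      = (2 * K + 5) * (L : ℝ) ^ 2 + C * ((2 * K + 5) * (L : ℝ) ^ 2) := by ring
  rw [abs_le, e2]
  constructor <;> linarith

/-! ### Taking expectations over the length -/

lemma eventually_pnat_ge (M : ℕ) : ∀ᶠ L : ℕ+ in atTop, M ≤ (L : ℕ) := by
  filter_upwards [eventually_ge_atTop (⟨M + 1, Nat.succ_pos M⟩ : ℕ+)] with L hL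
  have : M + 1 ≤ (L : ℕ) := hL
  omega

theorem theorem1 (d : ℕ) (hd : 3 ≤ d)
    (x : ℕ+ → Fin d → ℤ) (hx : ∀ L : ℕ+, x L ∈ torusBox d (L : ℕ))
    {Ω : ℕ+ → Type*} [∀ L, MeasurableSpace (Ω L)]
    (P : ∀ L, Measure (Ω L)) [∀ L, IsProbabilityMeasure (P L)]
    (C : ∀ L, ℕ → Ω L → Fin d → ℤ) (N : ∀ L, Ω L → ℕ)
    (hRLRW : ∀ L, IsRLRWData (P L) (C L) (N L))
    (hmean : ∀ᶠ L in atTop, Integrable (fun ω => (N L ω : ℝ)) (P L)) :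
    ((fun L => meanLength (P L) (N L)) =o[atTop] (fun L : ℕ+ => ((L : ℕ) : ℝ) ^ 2) →
      (fun L : ℕ+ => twoPointTorus (L : ℕ) (P L) (C L) (N L) (x L)
          - twoPointLattice (P L) (C L) (N L) (x L))
        =O[atTop] (fun L : ℕ+ => meanLength (P L) (N L) / ((L : ℕ) : ℝ) ^ d)) ∧
    ((fun L : ℕ+ => ((L : ℕ) : ℝ) ^ 2) =O[atTop] (fun L => meanLength (P L) (N L)) →
      ∃ c₁ > (0 : ℝ), ∃ c₂ > (0 : ℝ), ∀ᶠ L : ℕ+ in atTop,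
        c₁ * (meanLength (P L) (N L) / ((L : ℕ) : ℝ) ^ d)
            ≤ twoPointTorus (L : ℕ) (P L) (C L) (N L) (x L)
              - twoPointLattice (P L) (C L) (N L) (x L) ∧
        twoPointTorus (L : ℕ) (P L) (C L) (N L) (x L)
              - twoPointLattice (P L) (C L) (N L) (x L)
            ≤ c₂ * (meanLength (P L) (N L) / ((L : ℕ) : ℝ) ^ d)) ∧
    ((fun L : ℕ+ => ((L : ℕ) : ℝ) ^ 2) =o[atTop] (fun L => meanLength (P L) (N L)) →
      (fun L => latticeNorm (x L)) =o[atTop] (fun L : ℕ+ => ((L : ℕ) : ℝ)) →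
      (fun L : ℕ+ => twoPointTorus (L : ℕ) (P L) (C L) (N L) (x L)
          - twoPointLattice (P L) (C L) (N L) (x L))
        ~[atTop] (fun L : ℕ+ => meanLength (P L) (N L) / ((L : ℕ) : ℝ) ^ d)) := by

  have hd0 : 0 < d := by omega
  have hμ0 : ∀ L, 0 ≤ meanLength (P L) (N L) := fun L =>
    integral_nonneg fun ω => Nat.cast_nonneg _
  have hLd : ∀ L : ℕ+, (0 : ℝ) < ((L : ℕ) : ℝ) ^ d := fun L =>
    pow_pos (by exact_mod_cast L.pos) d
  obtain ⟨C₀, hC₀, hup⟩ := exists_excessVisits_le hd0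
  have hdata := fun (L : ℕ+) hN => (hRLRW L).twoPoint_sub_eq L.pos hN (hx L)
  have hupper : ∀ᶠ L : ℕ+ in atTop,
      0 ≤ twoPointTorus (L : ℕ) (P L) (C L) (N L) (x L) - twoPointLattice (P L) (C L) (N L) (x L) ∧
      twoPointTorus (L : ℕ) (P L) (C L) (N L) (x L) - twoPointLattice (P L) (C L) (N L) (x L)
        ≤ C₀ * (meanLength (P L) (N L) / ((L : ℕ) : ℝ) ^ d) := by
    filter_upwards [hmean] with L hN
    obtain ⟨hint, heq⟩ := hdata L hN
    rw [heq]
    refine ⟨integral_nonneg fun ω => excessVisits_nonneg _ _, ?_⟩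
    refine (integral_mono hint (hN.const_mul (C₀ / ((L : ℕ) : ℝ) ^ d))
      fun ω => hup L.pos (hx L) (N L ω)).trans (le_of_eq ?_)
    rw [integral_const_mul, meanLength]
    ring
  refine ⟨fun _ => ?_, fun hΩ => ?_, fun hω _ => ?_⟩
  · refine IsBigO.of_bound C₀ ?_
    filter_upwards [hupper] with L h
    rw [Real.norm_eq_abs, Real.norm_eq_abs, abs_of_nonneg h.1,
      abs_of_nonneg (div_nonneg (hμ0 L) (hLd L).le)]
    exact h.2
  · obtain ⟨c', hc', hb⟩ := hΩ.exists_pos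
    rw [IsBigOWith] at hb
    -- From `L² ≤ c' μ` this `ε` gives `ε L² ≤ μ / 4`, and `L ≥ 4 c'` gives `1 ≤ ε L²`. The loss `ε
    -- L² + 1` is then at most `μ / 2`, whence the constant `c / 2`.
    obtain ⟨c, hc, L₀, hlow⟩ := exists_le_excessVisits hd0 (ε := 1 / (4 * c')) (by positivity)
    refine ⟨c / 2, by positivity, C₀ + 1, by positivity, ?_⟩
    filter_upwards [hupper, hmean, hb, eventually_pnat_ge L₀, eventually_pnat_ge ⌈4 * c'⌉₊]
      with L hU hN hbL hL₀ hL₁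
    have hv : 0 ≤ meanLength (P L) (N L) / ((L : ℕ) : ℝ) ^ d := div_nonneg (hμ0 L) (hLd L).le
    refine ⟨?_, hU.2.trans (by linarith)⟩
    obtain ⟨hint, heq⟩ := hdata L hN
    rw [heq]
    set μ := meanLength (P L) (N L) with hμ
    rw [Real.norm_eq_abs, Real.norm_eq_abs, abs_of_nonneg (by positivity),
      abs_of_nonneg (hμ0 L)] at hbL
    have hL1 : (1 : ℝ) ≤ ((L : ℕ) : ℝ) := by exact_mod_cast L.pos
    have hL4 : 4 * c' ≤ ((L : ℕ) : ℝ) := (Nat.le_ceil _).trans (by exact_mod_cast hL₁)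
    have h1 : 1 / (4 * c') * ((L : ℕ) : ℝ) ^ 2 ≤ μ / 4 := by
      rw [one_div, inv_mul_le_iff₀ (by positivity)]
      linarith
    have h2 : 1 ≤ μ / 4 := by
      refine le_trans ?_ h1
      rw [one_div, le_inv_mul_iff₀ (by positivity)]
      nlinarith
    have h3 := integral_mono
      (f := fun ω => c / ((L : ℕ) : ℝ) ^ d
        * ((N L ω : ℝ) - (1 / (4 * c') * ((L : ℕ) : ℝ) ^ 2 + 1)))
      ((hN.sub (integrable_const _)).const_mul _) hint
      fun ω => hlow L.pos hL₀ (hx L) (N L ω)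
    rw [integral_const_mul, integral_sub hN (integrable_const _), integral_const] at h3
    simp only [probReal_univ, one_smul] at h3
    refine le_trans ?_ h3
    calc c / 2 * (μ / ((L : ℕ) : ℝ) ^ d) = c / ((L : ℕ) : ℝ) ^ d * (μ / 2) := by ring
      _ ≤ c / ((L : ℕ) : ℝ) ^ d * (μ - (1 / (4 * c') * ((L : ℕ) : ℝ) ^ 2 + 1)) := by
        have := hLd L
        gcongr
        linarith
  · rw [IsEquivalent, isLittleO_iff]
    intro η hη
    obtain ⟨B, hB, hdiff⟩ := exists_abs_excessVisits_sub_le hd0 (half_pos hη)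
    -- Makes `B L² ≤ (η / 2) μ`; the other half of `η` is the relative error in `m`.
    have hsmall := (isLittleO_iff.1 hω) (show 0 < η / (2 * B) by positivity)
    filter_upwards [hmean, hsmall] with L hN hsL
    obtain ⟨hint, heq⟩ := hdata L hN
    simp only [Pi.sub_apply]
    rw [heq]
    set μ := meanLength (P L) (N L) with hμ
    have hLd' := hLd L
    rw [Real.norm_eq_abs, Real.norm_eq_abs, abs_of_nonneg (by positivity),
      abs_of_nonneg (hμ0 L)] at hsL
    have hBL : B * ((L : ℕ) : ℝ) ^ 2 ≤ η / 2 * μ := by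
      calc B * ((L : ℕ) : ℝ) ^ 2 ≤ B * (η / (2 * B) * μ) := by gcongr
        _ = _ := by field_simp
    have e : (∫ ω, excessVisits d L (x L) (N L ω) ∂(P L)) - μ / ((L : ℕ) : ℝ) ^ d
        = ∫ ω, (excessVisits d L (x L) (N L ω) - (N L ω : ℝ) / ((L : ℕ) : ℝ) ^ d) ∂(P L) := by
      rw [integral_sub hint (hN.div_const _), integral_div, hμ, meanLength]
    rw [e, Real.norm_of_nonneg (div_nonneg (hμ0 L) hLd'.le)]
    have h1 := norm_integral_le_of_norm_le
      (f := fun ω => excessVisits d L (x L) (N L ω) - (N L ω : ℝ) / ((L : ℕ) : ℝ) ^ d)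
      (g := fun ω => (η / 2 * (N L ω : ℝ) + B * ((L : ℕ) : ℝ) ^ 2) / ((L : ℕ) : ℝ) ^ d)
      (((hN.const_mul (η / 2)).add (integrable_const _)).div_const _)
      (Eventually.of_forall fun ω => hdiff L.pos (hx L) (N L ω))
    rw [integral_div, integral_add (hN.const_mul (η / 2)) (integrable_const _),
      integral_const_mul, integral_const] at h1
    simp only [probReal_univ, one_smul] at h1
    refine h1.trans ?_
    rw [← mul_div_assoc]
    gcongr
    have : ∫ ω, (N L ω : ℝ) ∂(P L) = μ := rfl
    rw [this]
    linarith
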